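/- **Theorem A (Toponogov's theorem in Alexandrov geometry).** Let $k\in\mathbb R$ and let $X$ be a complete metric space (not assumed to be locally compact) in which any two points are joined by a minimal geodesic (a shortest path, whose length is the distance). Let $\mathbb S^2_k$ be the complete simply connected surface of constant curvature $k$. Assume that $X$ has curvature $\ge k$ in the sense of Alexandrov, i.e. every point of $X$ has a ball $B$ around it such that for all $p,q,r\in B$ and every point $s\in B$ lying on a minimal geodesic $[qr]$, one has $|ps|\ge|\tilde p\tilde s|$, whenever $\triangle\tilde p\tilde q\tilde r\subset\mathbb S^2_k$ is a comparison triangle (a triangle with $|\tilde p\tilde q|=|pq|$, $|\tilde p\tilde r|=|pr|$, $|\tilde q\tilde r|=|qr|$) and $\tilde s\in[\tilde q\tilde r]$ is the point with $|\tilde q\tilde s|=|qs|$, $|\tilde s\tilde r|=|sr|$. Then for any triangle $\triangle pqr\subset X$, that is, any points $p,q,r$ with $p\ne q\ne r$ together with three minimal geodesics $[pq],[qr],[pr]$, the angle $\angle pqr$ between $[qp]$ and $[qr]$ at $q$ (the limit of the Euclidean comparison angles at $q$ of $x,q,y$ as $x\in[qp]$, $y\in[qr]$ tend to $q$, $x,y\neq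 q$) exists, and $$\angle pqr\ \ge\ \tilde\angle_k pqr ,$$ where $\tilde\angle_k pqr=\angle\tilde p\tilde q\tilde r$ is the angle at $\tilde q$ of a comparison triangle $\triangle\tilde p\tilde q\tilde r\subset\mathbb S^2_k$ of $\triangle pqr$. Here, if $k>0$, the triangle is supposed to have a comparison triangle, i.e. $|pq|+|qr|+|pr|\le 2\pi/\sqrt k$, and by convention $\tilde\angle_k pqr=0$ if $|pq|=\pi/\sqrt k$ or $|qr|=\pi/\sqrt k$. -/

import Mathlib

open Filter Topology

noncomputable section

/-- `γ`, restricted to `[0, |xy|]`, is a minimal geodesic (shortest path, parametrized by arc length)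
from `x` to `y`. -/
def IsMinimalGeodesic {X : Type*} [MetricSpace X] (γ : ℝ → X) (x y : X) : Prop :=
  γ 0 = x ∧ γ (dist x y) = y ∧
    ∀ s ∈ Set.Icc 0 (dist x y), ∀ t ∈ Set.Icc 0 (dist x y), dist (γ s) (γ t) = |s - t|

/-- The angle opposite to the side `c` in a Euclidean triangle with sides `a, b, c`. -/
def euclideanComparisonAngle (a b c : ℝ) : ℝ :=
  Real.arccos ((a ^ 2 + b ^ 2 - c ^ 2) / (2 * a * b))

/-- The two minimal geodesics `γ`, `σ` issuing from `q` form the angle `α` at `q`: the Euclidean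
comparison angles at `q` of the triples `γ s, q, σ t` converge to `α` as `s, t → 0+`. -/
def HasAngle {X : Type*} [MetricSpace X] (q : X) (γ σ : ℝ → X) (α : ℝ) : Prop :=
  Tendsto
    (fun x : ℝ × ℝ =>
      euclideanComparisonAngle (dist q (γ x.1)) (dist q (σ x.2)) (dist (γ x.1) (σ x.2)))
    (𝓝[>] (0 : ℝ) ×ˢ 𝓝[>] (0 : ℝ)) (𝓝 α)

/-- Points of the complete simply connected surface `S²_k` of constant curvature `k`, as
points `(t, v)` of `ℝ × ℝ²`: the unit sphere `t² + |v|² = 1` if `k > 0`, the plane `t = 1`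
if `k = 0`, and the upper sheet of the hyperboloid `t² - |v|² = 1` if `k < 0`.
The distance, rescaled so that the curvature is `k`, is `ModelPlane.mdist`. -/
structure ModelPlane (k : ℝ) where
  t : ℝ
  v : EuclideanSpace ℝ (Fin 2)
  quadric : t ^ 2 + Real.sign k * ‖v‖ ^ 2 = 1
  pos : k ≤ 0 → 0 < t

namespace ModelPlane

variable {k : ℝ}

/-- The ambient form `t t' + sign(k) ⟨v, v'⟩`. -/
def form (x y : ModelPlane k) : ℝ := x.t * y.t + Real.sign k * inner ℝ x.v y.v

/-- The intrinsic distance of `S²_k`: great-circle distance divided by `√k` if `k > 0`, Euclidean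
distance if `k = 0`, hyperbolic distance divided by `√(-k)` if `k < 0`. -/
def mdist (x y : ModelPlane k) : ℝ :=
  if 0 < k then Real.arccos (form x y) / √k
  else if k = 0 then dist x.v y.v
  else Real.arcosh (form x y) / √(-k)

/-- The first component of `x - form(q, x) q`, the vector tangent to `S²_k` at `q` that
points in the direction of the shortest path from `q` to `x`. -/
def dirT (q x : ModelPlane k) : ℝ := x.t - form q x * q.t

/-- The second component of `x - form(q, x) q`. -/
def dirV (q x : ModelPlane k) : EuclideanSpace ℝ (Fin 2) := x.v - form q x • q.v

/-- The Riemannian inner product (up to the constant conformal factor) of the directions at `q`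
of `x` and `y`. -/
def dirInner (q x y : ModelPlane k) : ℝ :=
  inner ℝ (dirV q x) (dirV q y) + Real.sign k * (dirT q x * dirT q y)

/-- The angle `∠ x q y` in `S²_k` at the vertex `q`, for `x, y ≠ q`.
If `x` or `y` is antipodal to `q` (which is possible only for `k > 0`), the direction vanishes and
the angle is `0` by convention. -/
def mangle (x q y : ModelPlane k) : ℝ :=
  if dirInner q x x = 0 ∨ dirInner q y y = 0 then 0
  else Real.arccos (dirInner q x y / (√(dirInner q x x) * √(dirInner q y y)))

end ModelPlane

/-- The triangle `p' q' r'` in `S²_k` is a comparison triangle of `p, q, r`. -/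
def IsComparisonTriangle {X : Type*} [MetricSpace X] {k : ℝ} (p q r : X)
    (p' q' r' : ModelPlane k) : Prop :=
  p'.mdist q' = dist p q ∧ p'.mdist r' = dist p r ∧ q'.mdist r' = dist q r

theorem ModelPlane.exists_factor {x S : ℝ} (h : |x| ≤ S) : ∃ w : ℝ, w ^ 2 ≤ 1 ∧ x = S * w := by
  rcases eq_or_lt_of_le ((abs_nonneg x).trans h) with h0 | h0
  · refine ⟨0, by norm_num, ?_⟩
    rw [← h0] at h
    simpa using h
  · refine ⟨x / S, ?_, by field_simp⟩
    rw [div_pow, div_le_one (by positivity)]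
    exact sq_le_sq' (by linarith [(abs_le.1 h).1]) (abs_le.1 h).2

theorem ModelPlane.exists_points (k Ca Sa Cb Sb w : ℝ) (ha : Ca ^ 2 + Real.sign k * Sa ^ 2 = 1)
    (hb : Cb ^ 2 + Real.sign k * Sb ^ 2 = 1) (hCa : k ≤ 0 → 0 < Ca) (hCb : k ≤ 0 → 0 < Cb)
    (hw : w ^ 2 ≤ 1) :
    ∃ p q r : ModelPlane k, p.form q = Ca ∧ q.form r = Cb ∧
      p.form r = Ca * Cb + Real.sign k * (Sa * Sb * w) ∧
      dist p.v q.v = |Sa| ∧ dist q.v r.v = |Sb| ∧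
      dist p.v r.v = √(Sa ^ 2 + Sb ^ 2 - 2 * Sa * Sb * w) := by
  have h1 : √(1 - w ^ 2) ^ 2 = 1 - w ^ 2 := Real.sq_sqrt (by linarith)
  refine ⟨⟨Ca, !₂[Sa, 0], ?_, hCa⟩, ⟨1, 0, by simp, by simp⟩,
    ⟨Cb, !₂[Sb * w, Sb * √(1 - w ^ 2)], ?_, hCb⟩, ?_, ?_, ?_, ?_, ?_, ?_⟩
  · simpa [EuclideanSpace.norm_sq_eq] using ha
  · rw [EuclideanSpace.norm_sq_eq]; simp [mul_pow, h1]; linear_combination hb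
  · simp [ModelPlane.form]
  · simp [ModelPlane.form]
  · simp [ModelPlane.form, PiLp.inner_apply]; left; ring
  · simp [EuclideanSpace.norm_eq]
    exact Real.sqrt_sq_eq_abs _
  · simp [EuclideanSpace.norm_eq, mul_pow, h1]
    rw [← Real.sqrt_sq_eq_abs]; ring_nf
  · simp [EuclideanSpace.dist_eq, Real.dist_eq, mul_pow, h1]; congr 1; ring

/-- There is a triangle in `S²_k` with prescribed sides `a, b, c` subject to the usual inequalities. -/
theorem ModelPlane.exists_triangle (k a b c : ℝ) (ha : 0 ≤ a) (hb : 0 ≤ b) (hc : 0 ≤ c)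
    (h1 : a ≤ b + c) (h2 : b ≤ a + c) (h3 : c ≤ a + b) (hk : 0 < k → a + b + c ≤ 2 * Real.pi / √k) :
    ∃ p q r : ModelPlane k, p.mdist q = a ∧ p.mdist r = c ∧ q.mdist r = b := by
  rcases lt_trichotomy k 0 with h | h | h
  · have hs : 0 < √(-k) := Real.sqrt_pos.2 (by linarith)
    have e : Real.sign k = -1 := Real.sign_of_neg h
    set m := √(-k)
    have hx : |Real.cosh (m * a) * Real.cosh (m * b) - Real.cosh (m * c)|
        ≤ Real.sinh (m * a) * Real.sinh (m * b) := by
      have u1 : Real.cosh (m * c) ≤ Real.cosh (m * a + m * b) := by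
        rw [Real.cosh_le_cosh, abs_of_nonneg (by positivity), abs_of_nonneg (by positivity)]
        nlinarith
      have u2 : Real.cosh (m * a - m * b) ≤ Real.cosh (m * c) := by
        rw [Real.cosh_le_cosh, abs_of_nonneg (a := m * c) (by positivity), abs_le]
        constructor <;> nlinarith
      rw [Real.cosh_add] at u1
      rw [Real.cosh_sub] at u2
      rw [abs_le]; constructor <;> linarith
    obtain ⟨w, hw, hx⟩ := ModelPlane.exists_factor hx
    obtain ⟨p, q, r, f1, f2, f3, -⟩ := ModelPlane.exists_points k (Real.cosh (m * a)) (Real.sinh (m * a))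
      (Real.cosh (m * b)) (Real.sinh (m * b)) w
      (by rw [e]; linarith [Real.cosh_sq (m * a)]) (by rw [e]; linarith [Real.cosh_sq (m * b)])
      (fun _ => Real.cosh_pos _) (fun _ => Real.cosh_pos _) hw
    have f3' : p.form r = Real.cosh (m * c) := by rw [f3, e]; linarith
    refine ⟨p, q, r, ?_, ?_, ?_⟩ <;>
      simp only [ModelPlane.mdist, f1, f2, f3', if_neg h.not_gt, if_neg h.ne] <;>
      rw [Real.arcosh_cosh (by positivity)] <;> exact mul_div_cancel_left₀ _ hs.ne'
  · have hx : |(a ^ 2 + b ^ 2 - c ^ 2)| ≤ 2 * a * b := by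
      rw [abs_le]; constructor <;> nlinarith
    obtain ⟨w, hw, hx⟩ := ModelPlane.exists_factor hx
    obtain ⟨p, q, r, -, -, -, f1, f2, f3⟩ := ModelPlane.exists_points k 1 a 1 b w
      (by simp [h]) (by simp [h]) (by simp) (by simp) hw
    refine ⟨p, q, r, ?_, ?_, ?_⟩ <;> simp only [ModelPlane.mdist, h, lt_irrefl, if_false, if_true]
    · rw [f1, abs_of_nonneg ha]
    · rw [f3, ← hx]; ring_nf; exact Real.sqrt_sq hc
    · rw [f2, abs_of_nonneg hb]
  · have hs : 0 < √k := Real.sqrt_pos.2 h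
    have e : Real.sign k = 1 := Real.sign_of_pos h
    have hk := hk h
    set m := √k
    rw [le_div_iff₀ hs] at hk
    have ha' : m * a ≤ Real.pi := by nlinarith
    have hb' : m * b ≤ Real.pi := by nlinarith
    have hc' : m * c ≤ Real.pi := by nlinarith
    have hx : |Real.cos (m * c) - Real.cos (m * a) * Real.cos (m * b)|
        ≤ Real.sin (m * a) * Real.sin (m * b) := by
      have u1 : Real.cos (m * a + m * b) ≤ Real.cos (m * c) := by
        by_cases hh : m * a + m * b ≤ Real.pi
        · exact Real.cos_le_cos_of_nonneg_of_le_pi (by positivity) hh (by nlinarith)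
        · rw [← Real.cos_two_pi_sub (m * a + m * b)]
          exact Real.cos_le_cos_of_nonneg_of_le_pi (by positivity) (by linarith) (by nlinarith)
      have u2 : Real.cos (m * c) ≤ Real.cos (m * a - m * b) := by
        rw [← Real.cos_abs (m * a - m * b)]
        refine Real.cos_le_cos_of_nonneg_of_le_pi (abs_nonneg _) hc' ?_
        rw [abs_le]
        constructor <;> nlinarith
      rw [Real.cos_add] at u1
      rw [Real.cos_sub] at u2
      rw [abs_le]; constructor <;> linarith
    obtain ⟨w, hw, hx⟩ := ModelPlane.exists_factor hx
    obtain ⟨p, q, r, f1, f2, f3, -⟩ := ModelPlane.exists_points k (Real.cos (m * a)) (Real.sin (m * a))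
      (Real.cos (m * b)) (Real.sin (m * b)) w
      (by rw [e]; linarith [Real.cos_sq_add_sin_sq (m * a)])
      (by rw [e]; linarith [Real.cos_sq_add_sin_sq (m * b)])
      (fun h' => absurd h h'.not_gt) (fun h' => absurd h h'.not_gt) hw
    have f3' : p.form r = Real.cos (m * c) := by rw [f3, e]; linarith
    refine ⟨p, q, r, ?_, ?_, ?_⟩ <;>
      simp only [ModelPlane.mdist, f1, f2, f3', if_pos h] <;>
      rw [Real.arccos_cos (by positivity) (by assumption)] <;> exact mul_div_cancel_left₀ _ hs.ne'

/-- Every triple of points has a comparison triangle in `S²_k` if `k ≤ 0`; if `k > 0`, every triple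
of perimeter at most `2π/√k` has one. -/
theorem exists_isComparisonTriangle {X : Type*} [MetricSpace X] (k : ℝ) (p q r : X)
    (hk : 0 < k → dist p q + dist q r + dist p r ≤ 2 * Real.pi / √k) :
    ∃ p' q' r' : ModelPlane k, IsComparisonTriangle p q r p' q' r' :=
  ModelPlane.exists_triangle k _ _ _ dist_nonneg dist_nonneg dist_nonneg
    (by linarith [dist_triangle_right p q r]) (by linarith [dist_triangle_left q r p])
    (dist_triangle p q r) hk

/-- Curvature `≥ k` in the sense of Alexandrov, for a space in which any two points are joined by
a minimal geodesic: every point has a ball such that for all `p, q, r` in it and every `s` in it on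
a minimal geodesic `[qr]` (that is, `|qs| + |sr| = |qr|`), the corresponding point `s'` on the
side `[q'r']` of a comparison triangle `p' q' r'` in `S²_k` satisfies `|p's'| ≤ |ps|`. -/
def HasCurvatureGE (X : Type*) [MetricSpace X] (k : ℝ) : Prop :=
  ∀ x : X, ∃ ρ > 0, ∀ p ∈ Metric.ball x ρ, ∀ q ∈ Metric.ball x ρ, ∀ r ∈ Metric.ball x ρ,
    ∀ s ∈ Metric.ball x ρ, dist q s + dist s r = dist q r →
      ∀ p' q' r' s' : ModelPlane k, IsComparisonTriangle p q r p' q' r' →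
        q'.mdist s' = dist q s → s'.mdist r' = dist s r → p'.mdist s' ≤ dist p s

end

/-! The angle bound is equivalent to a hinge comparison: the side opposite to the vertex of a hinge
is at most the corresponding side of the hinge with the same legs and angle in `S²_k`. Sides are
measured by `md`, for which the cosine rule and Stewart's theorem are polynomial identities in `md`
and `sn`, uniform in the sign of `k`.

Locally, the curvature condition is Stewart's theorem with an inequality (`StewartOn`). It makes
comparison angles monotone in the legs, so that angles exist and small hinges satisfy the
comparison. Applied to a midpoint, it shows that adjacent angles add up to at most `π`.

To globalize, the vertex of a hinge slides along one leg. If two thinner hinges satisfy the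
comparison, the model side for the new hinge is at most that for the old one (`exists_hinge_step`,
Alexandrov's lemma), so it suffices to treat the new hinge. Sliding never increases the sum of the
legs. If the sum drops by a definite amount at each step, finitely many steps reach small hinges; if
it hardly drops, the angle is almost `π` and the triangle inequality already gives the claim up to
`ε`. Hence comparison for nearby hinges of size at most `5/6 * L` implies it for size `L`
(`hingeComparison_of_smaller`). A counterexample therefore produces a sequence of counterexamples
with geometrically decaying sizes, whose vertices converge by completeness to a point where the
local comparison is contradicted; no compactness of the space is needed.

For `k > 0` this covers sizes up to `π/√k`. Sliding with a small fixed step extends it to perimeters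
below `2π/√k`, and a limit argument treats equality. -/

/-- The generalized sine: the solution of `f'' + k f = 0`, `f 0 = 0`, `f' 0 = 1`. -/
noncomputable def sn (k x : ℝ) : ℝ :=
  if 0 < k then Real.sin (√k * x) / √k
  else if k = 0 then x
  else Real.sinh (√(-k) * x) / √(-k)

/-- The generalized cosine: the solution of `f'' + k f = 0`, `f 0 = 1`, `f' 0 = 0`. -/
noncomputable def cs (k x : ℝ) : ℝ :=
  if 0 < k then Real.cos (√k * x)
  else if k = 0 then 1
  else Real.cosh (√(-k) * x)

/-- The modified distance: the primitive of `sn k` that vanishes at `0`. -/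
noncomputable def md (k x : ℝ) : ℝ := 2 * sn k (x / 2) ^ 2

/-! ### Generalized trigonometry. -/

section Trig

variable (k : ℝ)

theorem sn_add (x y : ℝ) : sn k (x + y) = sn k x * cs k y + cs k x * sn k y := by
  unfold sn cs
  split_ifs with h h'
  · rw [mul_add, Real.sin_add]; ring
  · ring
  · rw [mul_add, Real.sinh_add]; ring

theorem cs_add (x y : ℝ) : cs k (x + y) = cs k x * cs k y - k * (sn k x * sn k y) := by
  unfold sn cs
  split_ifs with h h'
  · have : √k ≠ 0 := (Real.sqrt_pos.2 h).ne'
    have e : √k ^ 2 = k := Real.sq_sqrt h.le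
    rw [mul_add, Real.cos_add]; field_simp; rw [e]; ring
  · simp [h']
  · have hk : 0 < -k := by rcases lt_trichotomy k 0 with h1 | h1 | h1 <;> [linarith; tauto; tauto]
    have : √(-k) ≠ 0 := (Real.sqrt_pos.2 hk).ne'
    have e : √(-k) ^ 2 = -k := Real.sq_sqrt hk.le
    rw [mul_add, Real.cosh_add]; field_simp; rw [e]; ring

theorem sn_neg (x : ℝ) : sn k (-x) = -sn k x := by
  unfold sn; split_ifs <;> simp [neg_div]

theorem cs_neg (x : ℝ) : cs k (-x) = cs k x := by
  unfold cs; split_ifs <;> simp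

@[simp] theorem sn_zero : sn k 0 = 0 := by
  unfold sn; split_ifs <;> simp

@[simp] theorem cs_zero : cs k 0 = 1 := by
  unfold cs; split_ifs <;> simp

@[simp] theorem md_zero : md k 0 = 0 := by simp [md]

theorem cs_sq_add (x : ℝ) : cs k x ^ 2 + k * sn k x ^ 2 = 1 := by
  have := cs_add k x (-x)
  rw [add_neg_cancel, cs_zero, sn_neg, cs_neg] at this
  linarith

/-- Eliminates `cs` in favour of `md`, which unlike `cs` still determines the distance when `k = 0`.
-/
theorem cs_eq (x : ℝ) : cs k x = 1 - k * md k x := by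
  have h := cs_add k (x / 2) (x / 2)
  rw [add_halves] at h
  rw [h, md]; linear_combination cs_sq_add k (x / 2)

theorem sn_sq (x : ℝ) : sn k x ^ 2 = md k x * (2 - k * md k x) := by
  have h := sn_add k (x / 2) (x / 2)
  rw [add_halves] at h
  rw [h, md]; linear_combination (4 * sn k (x / 2) ^ 2) * cs_sq_add k (x / 2)

theorem sn_add' (x y : ℝ) :
    sn k (x + y) = sn k x * (1 - k * md k y) + (1 - k * md k x) * sn k y := by
  rw [sn_add, cs_eq, cs_eq]

theorem md_add (x y : ℝ) :
    md k (x + y) = md k x + md k y - k * md k x * md k y + sn k x * sn k y := by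
  have h1 := sn_add k (x / 2) (x / 2)
  have h2 := sn_add k (y / 2) (y / 2)
  rw [add_halves] at h1 h2
  rw [h1, h2, md, md, md, add_div, sn_add]
  linear_combination (2 * sn k (x / 2) ^ 2) * cs_sq_add k (y / 2)
    + (2 * sn k (y / 2) ^ 2) * cs_sq_add k (x / 2)

theorem md_neg (x : ℝ) : md k (-x) = md k x := by
  simp [md, neg_div, sn_neg]

/-- The product formula for a difference of cosines; it yields both the monotonicity of `md` and the
half-angle form of the cosine rule. -/
theorem md_sub_md (c d : ℝ) :
    md k c - md k d = 2 * (sn k ((c + d) / 2) * sn k ((c - d) / 2)) := by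
  rw [sub_div, add_div, sub_eq_add_neg, sub_eq_add_neg, sn_add, sn_add, sn_neg, cs_neg, md, md]
  linear_combination (-2 * sn k (c / 2) ^ 2) * cs_sq_add k (d / 2)
    + (2 * sn k (d / 2) ^ 2) * cs_sq_add k (c / 2)

/-- The relation between the values of `md` and `sn` at `x`, `y` and `x + y` that underlies
Stewart's theorem. -/
theorem sn_mul_md_add (x y : ℝ) :
    sn k x * md k (x + y) = sn k (x + y) * md k x + sn k x * md k y + sn k y * md k x := by
  rw [md_add, sn_add']
  linear_combination sn k y * sn_sq k x

theorem continuous_sn : Continuous (sn k) := by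
  unfold sn; split_ifs <;> fun_prop

theorem continuous_md : Continuous (md k) := by
  have := continuous_sn k
  unfold md; fun_prop

theorem hasDerivAt_sn_zero : HasDerivAt (sn k) 1 0 := by
  unfold sn
  rcases lt_trichotomy k 0 with h | h | h
  · have hs : √(-k) ≠ 0 := (Real.sqrt_pos.2 (by linarith)).ne'
    simp only [h.not_gt, h.ne, if_false]
    have := (((hasDerivAt_id (0 : ℝ)).const_mul √(-k)).sinh).div_const √(-k)
    simpa [hs] using this
  · simpa [h] using hasDerivAt_id' (0 : ℝ)
  · have hs : √k ≠ 0 := (Real.sqrt_pos.2 h).ne'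
    simp only [h, if_true]
    have := (((hasDerivAt_id (0 : ℝ)).const_mul √k).sin).div_const √k
    simpa [hs] using this

variable {k} {x y : ℝ}

theorem sn_pos (hx : 0 < x) (hk : 0 < k → x < Real.pi / √k) : 0 < sn k x := by
  unfold sn
  rcases lt_trichotomy k 0 with h | h | h
  · have hs : 0 < √(-k) := Real.sqrt_pos.2 (by linarith)
    simp only [h.not_gt, h.ne, if_false]
    exact div_pos (Real.sinh_pos_iff.2 (by positivity)) hs
  · simpa [h] using hx
  · have hs : 0 < √k := Real.sqrt_pos.2 h
    simp only [h, if_true]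
    refine div_pos (Real.sin_pos_of_pos_of_lt_pi (by positivity) ?_) hs
    rw [mul_comm]; exact (lt_div_iff₀ hs).1 (hk h)

theorem sn_pi_div (hk : 0 < k) : sn k (Real.pi / √k) = 0 := by
  have hs : √k ≠ 0 := (Real.sqrt_pos.2 hk).ne'
  simp [sn, hk, mul_div_cancel₀ _ hs]

theorem sn_pi_div_sub (hk : 0 < k) (x : ℝ) : sn k (Real.pi / √k - x) = sn k x := by
  have hs : √k ≠ 0 := (Real.sqrt_pos.2 hk).ne'
  simp [sn, hk, mul_sub, mul_div_cancel₀ _ hs]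

theorem md_two_pi_div_sub (hk : 0 < k) (x : ℝ) : md k (2 * Real.pi / √k - x) = md k x := by
  rw [md, md, ← sn_pi_div_sub hk (x / 2)]; congr 3; ring

theorem sn_nonneg (hx : 0 ≤ x) (hk : 0 < k → x ≤ Real.pi / √k) : 0 ≤ sn k x := by
  rcases hx.eq_or_lt with rfl | hx
  · simp
  by_cases h : 0 < k ∧ x = Real.pi / √k
  · rw [h.2, sn_pi_div h.1]
  · exact (sn_pos hx fun h0 => lt_of_le_of_ne (hk h0) fun h1 => h ⟨h0, h1⟩).le

theorem md_lt_md (hx : 0 ≤ x) (hxy : x < y) (hk : 0 < k → y ≤ Real.pi / √k) :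
    md k x < md k y := by
  have := md_sub_md k y x
  have h1 : 0 < sn k ((y + x) / 2) := sn_pos (by linarith) fun h => by linarith [hk h]
  have h2 : 0 < sn k ((y - x) / 2) := sn_pos (by linarith) fun h => by linarith [hk h]
  nlinarith [mul_pos h1 h2]

theorem md_le_md (hx : 0 ≤ x) (hxy : x ≤ y) (hk : 0 < k → y ≤ Real.pi / √k) :
    md k x ≤ md k y := by
  rcases hxy.eq_or_lt with rfl | h
  · exact le_rfl
  · exact (md_lt_md hx h hk).le

theorem le_of_md_le_md (hy : 0 ≤ y) (hk : 0 < k → x ≤ Real.pi / √k) (h : md k x ≤ md k y) :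
    x ≤ y := by
  by_contra! h'
  exact absurd (md_lt_md hy h' hk) h.not_gt

end Trig

/-! ### Hinges and comparison angles in terms of `md`. -/

/-- The modified length of the side opposite to an angle with cosine `A` between sides of lengths
`a`, `b` in `S²_k`. -/
noncomputable def hingeMd (k a b A : ℝ) : ℝ :=
  md k a + md k b - k * md k a * md k b - sn k a * sn k b * A

/-- The cosine of the angle opposite to the side `c` in a triangle in `S²_k` with sides
`a`, `b`, `c`. -/
noncomputable def cosAngle (k a b c : ℝ) : ℝ :=
  (md k a + md k b - k * md k a * md k b - md k c) / (sn k a * sn k b)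

theorem hingeMd_comm (k a b A : ℝ) : hingeMd k a b A = hingeMd k b a A := by
  unfold hingeMd; ring

theorem cosAngle_comm (k a b c : ℝ) : cosAngle k a b c = cosAngle k b a c := by
  unfold cosAngle; congr 1 <;> ring

/-- Measures the deviation from the straight hinge `A = -1`, whose opposite side is `a + b`. -/
theorem hingeMd_eq_md_add_sub (k a b A : ℝ) :
    hingeMd k a b A = md k (a + b) - sn k a * sn k b * (1 + A) := by
  rw [hingeMd, md_add]; ring

theorem le_cosAngle_iff {k a b c A : ℝ} (ha : 0 < sn k a) (hb : 0 < sn k b) :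
    A ≤ cosAngle k a b c ↔ md k c ≤ hingeMd k a b A := by
  rw [cosAngle, le_div_iff₀ (by positivity), hingeMd]
  constructor <;> intro h <;> linarith

/-- A product of values of `sn`, with no cancellation as the sides shrink; this permits comparison
with the Euclidean formula in the limit. -/
theorem one_sub_cosAngle {k a b c : ℝ} (ha : sn k a ≠ 0) (hb : sn k b ≠ 0) :
    1 - cosAngle k a b c =
      2 * (sn k ((c + (a - b)) / 2) * sn k ((c - (a - b)) / 2)) / (sn k a * sn k b) := by
  rw [← md_sub_md, sub_eq_add_neg a b, md_add, md_neg, sn_neg, cosAngle]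
  field_simp
  ring

theorem neg_one_le_cosAngle {k a b c : ℝ} (ha : 0 < a) (hb : 0 < b) (hc : 0 ≤ c)
    (h : c ≤ a + b) (hk : 0 < k → a + b ≤ Real.pi / √k) : -1 ≤ cosAngle k a b c := by
  rw [le_cosAngle_iff (sn_pos ha fun h => by linarith [hk h])
    (sn_pos hb fun h => by linarith [hk h]), hingeMd_eq_md_add_sub]
  simpa using md_le_md hc h hk

/-! ### Stewart's theorem, the cosine rule and perimeters in `S²_k`. -/

namespace ModelPlane

variable {k : ℝ}

theorem t_eq_one (hk : k = 0) (x : ModelPlane k) : x.t = 1 := by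
  have h1 := x.quadric
  have h2 := x.pos hk.le
  simp [hk] at h1
  rcases h1 with h | h <;> linarith

theorem form_comm (x y : ModelPlane k) : form x y = form y x := by
  rw [form, form, real_inner_comm]; ring

theorem mdist_comm (x y : ModelPlane k) : mdist x y = mdist y x := by
  rw [mdist, mdist, form_comm, dist_comm]

theorem abs_form_le_one (hk : 0 < k) (x y : ModelPlane k) : |form x y| ≤ 1 := by
  have hx := x.quadric
  have hy := y.quadric
  have h := abs_real_inner_le_norm x.v y.v
  rw [Real.sign_of_pos hk] at hx hy
  rw [form, Real.sign_of_pos hk]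
  rw [abs_le] at h ⊢
  constructor <;>
    nlinarith [sq_nonneg (x.t - y.t), sq_nonneg (x.t + y.t), sq_nonneg (‖x.v‖ - ‖y.v‖)]

theorem one_le_form (hk : k < 0) (x y : ModelPlane k) : 1 ≤ form x y := by
  have hx := x.quadric
  have hy := y.quadric
  have hx' := x.pos hk.le
  have hy' := y.pos hk.le
  have h := (abs_le.1 (abs_real_inner_le_norm x.v y.v)).2
  rw [Real.sign_of_neg hk] at hx hy
  rw [form, Real.sign_of_neg hk]
  have h1 : (1 + ‖x.v‖ * ‖y.v‖) ^ 2 ≤ (x.t * y.t) ^ 2 := by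
    have e1 : x.t ^ 2 = 1 + ‖x.v‖ ^ 2 := by linarith
    have e2 : y.t ^ 2 = 1 + ‖y.v‖ ^ 2 := by linarith
    rw [mul_pow, e1, e2]
    nlinarith [sq_nonneg (‖x.v‖ - ‖y.v‖)]
  have h2 := (sq_le_sq₀ (by positivity) (by positivity)).1 h1
  linarith

theorem mdist_nonneg (x y : ModelPlane k) : 0 ≤ mdist x y := by
  unfold mdist
  split_ifs with h h'
  · exact div_nonneg (Real.arccos_nonneg _) (Real.sqrt_nonneg _)
  · exact dist_nonneg
  · have hk : k < 0 := lt_of_le_of_ne (not_lt.1 h) h'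
    exact div_nonneg (Real.arcosh_nonneg (one_le_form hk x y)) (Real.sqrt_nonneg _)

theorem mdist_le (hk : 0 < k) (x y : ModelPlane k) : mdist x y ≤ Real.pi / √k := by
  rw [mdist, if_pos hk]
  have := Real.arccos_le_pi (form x y)
  gcongr

theorem cs_mdist (x y : ModelPlane k) : cs k (mdist x y) = form x y := by
  unfold cs mdist
  rcases lt_trichotomy k 0 with h | h | h
  · have hs : √(-k) ≠ 0 := (Real.sqrt_pos.2 (by linarith)).ne'
    simp only [h.not_gt, h.ne, if_false]
    rw [mul_div_cancel₀ _ hs, Real.cosh_arcosh (one_le_form h x y)]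
  · rw [form, t_eq_one h, t_eq_one h]; simp [h]
  · have hs : √k ≠ 0 := (Real.sqrt_pos.2 h).ne'
    have h1 := abs_le.1 (abs_form_le_one h x y)
    simp only [h, if_true]
    rw [mul_div_cancel₀ _ hs, Real.cos_arccos h1.1 h1.2]

theorem mul_md_mdist (x y : ModelPlane k) : k * md k (mdist x y) = 1 - form x y := by
  rw [← cs_mdist, cs_eq]; ring

theorem md_mdist_of_eq_zero (hk : k = 0) (x y : ModelPlane k) :
    md k (mdist x y) = ‖x.v - y.v‖ ^ 2 / 2 := by
  simp [md, sn, mdist, hk, dist_eq_norm]; ring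

theorem md_mdist_self (x : ModelPlane k) : md k (mdist x x) = 0 := by
  by_cases h0 : k = 0
  · rw [md_mdist_of_eq_zero h0]; simp
  · apply mul_left_cancel₀ h0
    rw [mul_md_mdist, form, real_inner_self_eq_norm_sq]
    linarith [x.quadric]

theorem mdist_eq_of_md_eq {x y : ModelPlane k} {d : ℝ} (hd : 0 ≤ d)
    (hk : 0 < k → d ≤ Real.pi / √k) (h : md k (mdist x y) = md k d) : mdist x y = d :=
  le_antisymm (le_of_md_le_md hd (fun h => mdist_le h x y) h.le)
    (le_of_md_le_md (mdist_nonneg x y) hk h.ge)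

/-- Stewart's theorem in `S²_k`: the distances from the points of a side to the other points. -/
theorem exists_stewart (q r : ModelPlane k) {s u : ℝ} (hs : 0 ≤ s) (hu : 0 ≤ u) (hsu : 0 < s + u)
    (hk : 0 < k → s + u < Real.pi / √k) (hqr : mdist q r = s + u) :
    ∃ z : ModelPlane k, mdist q z = s ∧ mdist z r = u ∧ ∀ p : ModelPlane k,
      sn k (s + u) * md k (mdist p z) + sn k s * md k u + sn k u * md k s =
        sn k u * md k (mdist p q) + sn k s * md k (mdist p r) := by
  have hS : 0 < sn k (s + u) := sn_pos hsu hk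
  have hs' : 0 ≤ sn k s := sn_nonneg hs fun h => by linarith [hk h]
  have hu' : 0 ≤ sn k u := sn_nonneg hu fun h => by linarith [hk h]
  have hadd : sn k (s + u) = sn k s * cs k u + cs k s * sn k u := sn_add k s u
  have hform : form q r = cs k (s + u) := by rw [← hqr, cs_mdist]
  -- The point is the ambient combination `(sn u · q + sn s · r) / sn (s + u)`. For `k ≠ 0` the
  -- identity is linearity of `form`; for `k = 0` the form is constantly `1`, so Euclidean norms are
  -- expanded instead.
  have key : ∃ z : ModelPlane k, ∀ p : ModelPlane k,
      sn k (s + u) * md k (mdist p z) + sn k s * md k u + sn k u * md k s =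
        sn k u * md k (mdist p q) + sn k s * md k (mdist p r) := by
    have hquad : ((sn k u * q.t + sn k s * r.t) / sn k (s + u)) ^ 2 + Real.sign k *
        ‖(sn k (s + u))⁻¹ • (sn k u • q.v + sn k s • r.v)‖ ^ 2 = 1 := by
      rw [norm_smul, mul_pow, norm_add_sq_real, norm_smul, norm_smul, real_inner_smul_left,
        real_inner_smul_right, mul_pow, mul_pow]
      simp only [Real.norm_eq_abs, sq_abs]
      have hq := q.quadric
      have hr := r.quadric
      rw [form] at hform
      have h1 := cs_sq_add k s
      have h2 := cs_sq_add k u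
      rw [cs_add] at hform
      field_simp
      rw [hadd]
      linear_combination sn k u ^ 2 * hq + sn k s ^ 2 * hr + 2 * sn k u * sn k s * hform
        - sn k u ^ 2 * h1 - sn k s ^ 2 * h2
    have hpos : k ≤ 0 → 0 < (sn k u * q.t + sn k s * r.t) / sn k (s + u) := fun h0 => by
      have hq := q.pos h0
      have hr := r.pos h0
      refine div_pos ?_ hS
      rcases hs.eq_or_lt with rfl | hs0
      · rw [zero_add] at hS
        simpa using mul_pos hS hq
      · have : 0 < sn k s := sn_pos hs0 fun h => absurd h h0.not_gt
        positivity
    refine ⟨⟨(sn k u * q.t + sn k s * r.t) / sn k (s + u),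
      (sn k (s + u))⁻¹ • (sn k u • q.v + sn k s • r.v), hquad, hpos⟩, fun p => ?_⟩
    by_cases h0 : k = 0
    · rw [md_mdist_of_eq_zero h0, md_mdist_of_eq_zero h0, md_mdist_of_eq_zero h0]
      have hR : ‖q.v - r.v‖ ^ 2 = (s + u) ^ 2 := by
        have := md_mdist_of_eq_zero h0 q r
        rw [hqr] at this
        simp [md, sn, h0] at this
        linarith
      subst h0
      simp only [md, sn, lt_irrefl, if_false, if_true]
      have e : p.v - (s + u)⁻¹ • (u • q.v + s • r.v)
          = (s + u)⁻¹ • (u • (p.v - q.v) + s • (p.v - r.v)) := by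
        rw [← smul_right_injective _ hsu.ne' |>.eq_iff]
        simp only [smul_sub, smul_inv_smul₀ hsu.ne', add_smul]
        abel
      have e2 : q.v - r.v = (p.v - r.v) - (p.v - q.v) := by abel
      rw [e, norm_smul, mul_pow, norm_add_sq_real, norm_smul, norm_smul, real_inner_smul_left,
        real_inner_smul_right]
      rw [e2, norm_sub_sq_real, real_inner_comm] at hR
      simp only [Real.norm_eq_abs, sq_abs, mul_pow]
      field_simp
      linear_combination (-s * u) * hR
    · apply mul_left_cancel₀ h0
      have h1 := mul_md_mdist p q
      have h2 := mul_md_mdist p r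
      have h3 := mul_md_mdist p ⟨(sn k u * q.t + sn k s * r.t) / sn k (s + u),
        (sn k (s + u))⁻¹ • (sn k u • q.v + sn k s • r.v), hquad, hpos⟩
      have h4 := cs_eq k s
      have h5 := cs_eq k u
      have h6 : sn k (s + u) * form p ⟨(sn k u * q.t + sn k s * r.t) / sn k (s + u),
        (sn k (s + u))⁻¹ • (sn k u • q.v + sn k s • r.v), hquad, hpos⟩ =
          sn k u * form p q + sn k s * form p r := by
        simp only [form, inner_smul_right, inner_add_right]
        field_simp
        ring
      linear_combination sn k (s + u) * h3 - sn k u * h1 - sn k s * h2 - h6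
        + hadd + sn k u * h4 + sn k s * h5
  obtain ⟨z, hz⟩ := key
  -- The distances of `z` from `q` and `r` follow from the identity itself, at `p = q` and `p = r`.
  refine ⟨z, mdist_eq_of_md_eq hs (fun h => by linarith [hk h]) ?_, ?_, hz⟩
  · have h1 := hz q
    rw [md_mdist_self, hqr] at h1
    apply mul_left_cancel₀ hS.ne'
    linarith [sn_mul_md_add k s u]
  · rw [mdist_comm]
    refine mdist_eq_of_md_eq hu (fun h => by linarith [hk h]) ?_
    have h1 := hz r
    rw [md_mdist_self, mdist_comm r q, hqr] at h1
    apply mul_left_cancel₀ hS.ne'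
    have h2 := sn_mul_md_add k u s
    rw [add_comm u s] at h2
    linarith

theorem dirInner_eq (hk : k ≠ 0) (q x y : ModelPlane k) :
    dirInner q x y = Real.sign k * (form x y - form q x * form q y) := by
  have hq := q.quadric
  have hs : Real.sign k * Real.sign k = 1 := by
    rcases lt_or_gt_of_ne hk with h | h <;> simp [Real.sign_of_neg, Real.sign_of_pos, h]
  have e1 : form q x = q.t * x.t + Real.sign k * inner ℝ q.v x.v := rfl
  have e2 : form q y = q.t * y.t + Real.sign k * inner ℝ q.v y.v := rfl
  rw [dirInner, dirT, dirT, dirV, dirV, inner_sub_left, inner_sub_right, inner_sub_right,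
    real_inner_smul_left, real_inner_smul_left, real_inner_smul_right, real_inner_smul_right,
    real_inner_self_eq_norm_sq, real_inner_comm q.v x.v]
  have e3 : form x y = x.t * y.t + Real.sign k * inner ℝ x.v y.v := rfl
  rw [e3]
  generalize form q x = f at *
  generalize form q y = g at *
  linear_combination (-inner ℝ x.v y.v + g * inner ℝ q.v x.v + f * inner ℝ q.v y.v
    - f * g * ‖q.v‖ ^ 2) * hs
    + (Real.sign k * f * g) * hq - Real.sign k * g * (-e1) - Real.sign k * f * (-e2)

/-- The cosine rule in `S²_k`. -/
theorem dirInner_eq_mul (q : ModelPlane k) : ∃ c > 0, ∀ x y : ModelPlane k,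
    dirInner q x y = c * (md k (mdist q x) + md k (mdist q y)
      - k * md k (mdist q x) * md k (mdist q y) - md k (mdist x y)) := by
  by_cases hk : k = 0
  · refine ⟨1, one_pos, fun x y => ?_⟩
    rw [md_mdist_of_eq_zero hk, md_mdist_of_eq_zero hk, md_mdist_of_eq_zero hk, dirInner]
    have hf : ∀ x, form q x = 1 := fun x => by
      rw [form, t_eq_one hk, t_eq_one hk]; simp [hk]
    have e : x.v - y.v = (q.v - y.v) - (q.v - x.v) := by abel
    rw [e, norm_sub_sq_real (q.v - y.v), dirV, dirV, hf, hf, one_smul, ← inner_neg_neg, neg_sub, neg_sub,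
      real_inner_comm]
    simp [hk]; ring
  -- The factor is `|k|`: the ambient quadric is not rescaled, the distance is.
  · refine ⟨Real.sign k * k, ?_, fun x y => ?_⟩
    · rcases lt_or_gt_of_ne hk with h | h <;> simp [Real.sign_of_neg, Real.sign_of_pos, h]
    · rw [dirInner_eq hk]
      linear_combination Real.sign k * (mul_md_mdist x y - form q y * mul_md_mdist q x
        - (1 - k * md k (mdist q x)) * mul_md_mdist q y)

/-- The angles of `S²_k` are given by the cosine rule. -/
theorem mangle_eq_arccos (q x y : ModelPlane k) (hx : 0 < sn k (mdist q x))
    (hy : 0 < sn k (mdist q y)) :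
    mangle x q y = Real.arccos (cosAngle k (mdist q x) (mdist q y) (mdist x y)) := by
  obtain ⟨c, hc, h⟩ := dirInner_eq_mul q
  have hself : ∀ x, dirInner q x x = c * sn k (mdist q x) ^ 2 := fun x => by
    rw [h, md_mdist_self, sn_sq]; ring
  have h1 : 0 < dirInner q x x := by rw [hself]; positivity
  have h2 : 0 < dirInner q y y := by rw [hself]; positivity
  rw [mangle, if_neg (by simp [h1.ne', h2.ne']), hself, hself, Real.sqrt_mul hc.le,
    Real.sqrt_mul hc.le, Real.sqrt_sq hx.le, Real.sqrt_sq hy.le, h, cosAngle]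
  have h3 : √c * √c = c := Real.mul_self_sqrt hc.le
  have h4 : √c * sn k (mdist q x) * (√c * sn k (mdist q y))
      = c * (sn k (mdist q x) * sn k (mdist q y)) := by
    linear_combination (sn k (mdist q x) * sn k (mdist q y)) * h3
  rw [h4, mul_div_mul_left _ _ hc.ne']

theorem mangle_eq_zero (q x y : ModelPlane k)
    (h : sn k (mdist q x) = 0 ∨ sn k (mdist q y) = 0) : mangle x q y = 0 := by
  obtain ⟨c, hc, hc'⟩ := dirInner_eq_mul q
  have hself : ∀ x, dirInner q x x = c * sn k (mdist q x) ^ 2 := fun x => by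
    rw [hc', md_mdist_self, sn_sq]; ring
  rw [mangle, if_pos]
  rcases h with h | h <;> simp [hself, h]

/-- Cauchy–Schwarz, since for `k > 0` the ambient form is the Euclidean inner product of `ℝ × ℝ²`.
-/
theorem dirInner_sq_le (hk : 0 < k) (q x y : ModelPlane k) :
    dirInner q x y ^ 2 ≤ dirInner q x x * dirInner q y y := by
  simp only [dirInner, Real.sign_of_pos hk, one_mul, real_inner_self_eq_norm_sq]
  generalize dirT q x = t
  generalize dirT q y = t'
  have h := abs_real_inner_le_norm (dirV q x) (dirV q y)
  generalize inner ℝ (dirV q x) (dirV q y) = i at *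
  have h1 : |i + t * t'| ≤ ‖dirV q x‖ * ‖dirV q y‖ + |t| * |t'| := by
    rw [← abs_mul]
    exact (abs_add_le _ _).trans (by gcongr)
  have h2 := pow_le_pow_left₀ (abs_nonneg _) h1 2
  rw [sq_abs] at h2
  rw [← pow_two, ← pow_two, ← sq_abs t, ← sq_abs t']
  nlinarith [sq_nonneg (‖dirV q x‖ * |t'| - ‖dirV q y‖ * |t|)]

/-- The perimeter of a triangle of the sphere `S²_k` is at most `2π/√k`. -/
theorem perimeter_le (hk : 0 < k) (q x y : ModelPlane k) :
    mdist q x + mdist q y + mdist x y ≤ 2 * Real.pi / √k := by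
  have hx := sn_nonneg (mdist_nonneg q x) fun _ => mdist_le hk q x
  have hy := sn_nonneg (mdist_nonneg q y) fun _ => mdist_le hk q y
  -- By Cauchy–Schwarz the cosine of the angle at `q` is at least `-1`.
  have hkey : md k (mdist x y) ≤ md k (mdist q x + mdist q y) := by
    obtain ⟨c, hc, h⟩ := dirInner_eq_mul q
    have h1 := dirInner_sq_le hk q x y
    have h2 : dirInner q x x * dirInner q y y
        = (c * (sn k (mdist q x) * sn k (mdist q y))) ^ 2 := by
      rw [h, h, md_mdist_self, md_mdist_self, mul_pow, mul_pow, sn_sq, sn_sq]; ring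
    rw [h2, h] at h1
    have h3 := le_of_mul_le_mul_left
      ((mul_neg _ _).trans_le (abs_le_of_sq_le_sq' h1 (by positivity)).1) hc
    rw [md_add]
    linarith
  by_contra! h
  have h0 := mdist_le hk x y
  -- A larger perimeter would put the reflected length `2π/√k - (|qx| + |qy|)` below `|xy|`, against
  -- the monotonicity of `md` on `[0, π/√k]`.
  rw [← md_two_pi_div_sub hk (mdist q x + mdist q y)] at hkey
  have := le_of_md_le_md
    (by rw [mul_div_assoc]; linarith [mdist_le hk q x, mdist_le hk q y]) (fun _ => h0) hkey
  linarith

end ModelPlane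

/-! ### Subarcs of minimal geodesics. -/

section Geodesic

variable {X : Type*} [MetricSpace X] {γ : ℝ → X} {x y : X} {h s : ℝ}

namespace IsMinimalGeodesic

theorem dist_left (hγ : IsMinimalGeodesic γ x y) (h0 : 0 ≤ s) (h1 : s ≤ dist x y) :
    dist x (γ s) = s := by
  have := hγ.2.2 0 ⟨le_rfl, dist_nonneg⟩ s ⟨h0, h1⟩
  rwa [hγ.1, zero_sub, abs_neg, abs_of_nonneg h0] at this

theorem dist_right (hγ : IsMinimalGeodesic γ x y) (h0 : 0 ≤ s) (h1 : s ≤ dist x y) :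
    dist (γ s) y = dist x y - s := by
  have := hγ.2.2 s ⟨h0, h1⟩ _ ⟨dist_nonneg, le_rfl⟩
  rwa [hγ.2.1, abs_sub_comm, abs_of_nonneg (by linarith)] at this

theorem initial (hγ : IsMinimalGeodesic γ x y) (h0 : 0 ≤ h) (h1 : h ≤ dist x y) :
    IsMinimalGeodesic γ x (γ h) := by
  rw [IsMinimalGeodesic, hγ.dist_left h0 h1]
  exact ⟨hγ.1, rfl, fun s hs t ht => hγ.2.2 s ⟨hs.1, hs.2.trans h1⟩ t ⟨ht.1, ht.2.trans h1⟩⟩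

theorem shift (hγ : IsMinimalGeodesic γ x y) (h0 : 0 ≤ h) (h1 : h ≤ dist x y) :
    IsMinimalGeodesic (fun t => γ (h + t)) (γ h) y := by
  rw [IsMinimalGeodesic, hγ.dist_right h0 h1]
  refine ⟨by simp, by simpa using hγ.2.1, fun s hs t ht => ?_⟩
  rw [hγ.2.2 _ ⟨by linarith [hs.1], by linarith [hs.2]⟩ _ ⟨by linarith [ht.1], by linarith [ht.2]⟩]
  congr 1; ring

theorem reverse (hγ : IsMinimalGeodesic γ x y) (h0 : 0 ≤ h) (h1 : h ≤ dist x y) :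
    IsMinimalGeodesic (fun t => γ (h - t)) (γ h) x := by
  rw [IsMinimalGeodesic, dist_comm _ x, hγ.dist_left h0 h1]
  refine ⟨by simp, by simpa using hγ.1, fun s hs t ht => ?_⟩
  rw [hγ.2.2 _ ⟨by linarith [hs.2], by linarith [hs.1]⟩ _ ⟨by linarith [ht.2], by linarith [ht.1]⟩,
    abs_sub_comm]
  congr 1; ring

end IsMinimalGeodesic

end Geodesic

/-! ### Local consequences of the curvature bound: angles and small hinges. -/

section Local

variable {X : Type*} [MetricSpace X]

/-- The inequality form of Stewart's theorem holds for all quadruples of points of the ball of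
radius `ρ` around `x`. -/
def StewartOn (k : ℝ) (x : X) (ρ : ℝ) : Prop :=
  ∀ p ∈ Metric.ball x ρ, ∀ q ∈ Metric.ball x ρ, ∀ r ∈ Metric.ball x ρ, ∀ s ∈ Metric.ball x ρ,
    dist q s + dist s r = dist q r →
      sn k (dist s r) * md k (dist p q) + sn k (dist q s) * md k (dist p r) ≤
        sn k (dist q r) * md k (dist p s) + sn k (dist q s) * md k (dist s r)
          + sn k (dist s r) * md k (dist q s)

/-- The comparison point satisfies Stewart's identity in `S²_k`; replacing its distance to `p'` by
the larger distance in `X` leaves an inequality. -/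
theorem HasCurvatureGE.exists_stewartOn {k : ℝ} (hX : HasCurvatureGE X k) (x : X) :
    ∃ ρ > 0, (0 < k → ρ ≤ Real.pi / √k) ∧ StewartOn k x ρ := by
  obtain ⟨ρ, hρ, H⟩ := hX x
  -- Points of a ball of radius `δ` have mutual distances below `2 * δ`, so perimeters stay below `6
  -- * δ ≤ 2π/√k` and comparison triangles exist.
  obtain ⟨δ, hδ, hδk⟩ : ∃ δ > 0, 0 < k → δ ≤ Real.pi / √k / 3 := by
    by_cases hk : 0 < k
    · exact ⟨Real.pi / √k / 3, by have := Real.sqrt_pos.2 hk; positivity, fun _ => le_rfl⟩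
    · exact ⟨1, one_pos, fun h => absurd h hk⟩
  refine ⟨min ρ δ, lt_min hρ hδ, fun hk => ?_, fun p hp q hq r hr s hs hqsr => ?_⟩
  · have := hδk hk
    have := min_le_right ρ δ
    linarith
  have hd : ∀ a ∈ Metric.ball x (min ρ δ), ∀ b ∈ Metric.ball x (min ρ δ), dist a b < 2 * δ := by
    intro a ha b hb
    rw [Metric.mem_ball] at ha hb
    linarith [dist_triangle_right a b x, min_le_right ρ δ]
  have hsub := Metric.ball_subset_ball (x := x) (min_le_left ρ δ)
  rcases (dist_nonneg (x := q) (y := r)).eq_or_lt with h0 | h0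
  · have e1 : q = r := dist_eq_zero.1 h0.symm
    have e2 : dist q s = 0 := by
      linarith [dist_nonneg (x := q) (y := s), dist_nonneg (x := s) (y := r)]
    have e3 : dist s r = 0 := by linarith
    rw [e2, e3, ← h0]; simp
  obtain ⟨p', q', r', hcomp⟩ := exists_isComparisonTriangle k p q r fun hk => by
    rw [mul_div_assoc]
    linarith [hδk hk, hd p hp q hq, hd q hq r hr, hd p hp r hr]
  obtain ⟨s', hs1, hs2, hs3⟩ := ModelPlane.exists_stewart q' r' dist_nonneg dist_nonneg
    (hqsr ▸ h0) (fun hk => by linarith [hδk hk, hd q hq r hr]) (hcomp.2.2.trans hqsr.symm)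
  have h1 := H p (hsub hp) q (hsub hq) r (hsub hr) s (hsub hs) hqsr p' q' r' s' hcomp hs1 hs2
  have h2 := hs3 p'
  rw [hcomp.1, hcomp.2.1, hqsr] at h2
  have h3 : md k (p'.mdist s') ≤ md k (dist p s) :=
    md_le_md (ModelPlane.mdist_nonneg _ _) h1 fun hk => by linarith [hδk hk, hd p hp s hs]
  have h4 : 0 ≤ sn k (dist q r) := sn_nonneg h0.le fun hk => by linarith [hδk hk, hd q hq r hr]
  linarith [mul_le_mul_of_nonneg_left h3 h4]

/-- The minimal geodesics `γ`, `σ` with the same starting point form an angle of cosine `A`,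
measured by comparison with `S²_k`. -/
def HasCosAngle (k : ℝ) (γ σ : ℝ → X) (A : ℝ) : Prop :=
  Tendsto (fun x : ℝ × ℝ => cosAngle k x.1 x.2 (dist (γ x.1) (σ x.2)))
    (𝓝[>] (0 : ℝ) ×ˢ 𝓝[>] (0 : ℝ)) (𝓝 A)

theorem HasCosAngle.symm {k A : ℝ} {γ σ : ℝ → X} (h : HasCosAngle k γ σ A) :
    HasCosAngle k σ γ A := by
  refine (h.comp tendsto_prod_swap).congr fun x => ?_
  simp only [Function.comp, Prod.fst_swap, Prod.snd_swap]
  rw [cosAngle_comm, dist_comm]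

theorem HasCosAngle.unique {k A B : ℝ} {γ σ : ℝ → X} (hA : HasCosAngle k γ σ A)
    (hB : HasCosAngle k γ σ B) : A = B :=
  tendsto_nhds_unique hA hB

theorem eventually_prod_nhdsGT {ε δ : ℝ} (hε : 0 < ε) (hδ : 0 < δ) :
    ∀ᶠ x : ℝ × ℝ in 𝓝[>] (0 : ℝ) ×ˢ 𝓝[>] (0 : ℝ),
      (0 < x.1 ∧ x.1 < ε) ∧ (0 < x.2 ∧ x.2 < δ) :=
  Filter.Eventually.prod_mk (Ioo_mem_nhdsGT hε) (Ioo_mem_nhdsGT hδ)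

/-- In a space of curvature `≥ k`, the comparison angles of a hinge do not increase with the
length of its sides. -/
theorem StewartOn.cosAngle_le {k ρ : ℝ} {x y p q : X} (hS : StewartOn k x ρ)
    (hρ : 0 < k → ρ ≤ Real.pi / √k) (hy : dist y x < ρ / 2) {γ σ : ℝ → X}
    (hγ : IsMinimalGeodesic γ y p) (hσ : IsMinimalGeodesic σ y q) {s' s t : ℝ} (h0 : 0 < s')
    (h1 : s' ≤ s) (h2 : s ≤ dist y p) (h3 : s < ρ / 2) (ht : 0 < t) (ht1 : t ≤ dist y q)
    (ht2 : t < ρ / 2) :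
    cosAngle k s' t (dist (γ s') (σ t)) ≤ cosAngle k s t (dist (γ s) (σ t)) := by
  have hρ0 : 0 < ρ := by linarith [dist_nonneg (x := y) (y := x)]
  have d1 := hγ.dist_left h0.le (h1.trans h2)
  have d2 := hγ.dist_left (h0.le.trans h1) h2
  have d3 := hσ.dist_left ht.le ht1
  have d4 := hγ.2.2 s' ⟨h0.le, h1.trans h2⟩ s ⟨h0.le.trans h1, h2⟩
  rw [abs_sub_comm, abs_of_nonneg (by linarith)] at d4
  have hball : ∀ z, dist y z < ρ / 2 → z ∈ Metric.ball x ρ := fun z hz => by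
    rw [Metric.mem_ball]
    linarith [dist_triangle_left z x y]
  -- Stewart's inequality for the point `σ t` and the side from `y` to `γ s`, divided at `γ s'`.
  have key := hS (σ t) (hball _ (by rwa [d3])) y (hball _ (by simpa using hρ0)) (γ s)
    (hball _ (by rwa [d2])) (γ s') (hball _ (by linarith)) (by linarith)
  rw [d1, d2, d4, dist_comm _ y, d3, dist_comm _ (γ s), dist_comm _ (γ s')] at key
  have ps : 0 < sn k s := sn_pos (by linarith) fun hk => by linarith [hρ hk]
  have ps' : 0 < sn k s' := sn_pos h0 fun hk => by linarith [hρ hk]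
  have pt : 0 < sn k t := sn_pos ht fun hk => by linarith [hρ hk]
  rw [cosAngle, cosAngle, div_le_div_iff₀ (by positivity) (by positivity)]
  have e1 := sn_mul_md_add k s' (s - s')
  have e2 := sn_add' k s' (s - s')
  have e3 := sn_add' k s (-s')
  rw [sn_neg, md_neg, ← sub_eq_add_neg] at e3
  rw [add_sub_cancel] at e1 e2
  suffices sn k s * (md k s' + md k t - k * md k s' * md k t - md k (dist (γ s') (σ t)))
      ≤ sn k s' * (md k s + md k t - k * md k s * md k t - md k (dist (γ s) (σ t))) by
    nlinarith [mul_le_mul_of_nonneg_left this pt.le]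
  have e4 : sn k (s - s') * md k t =
      (sn k s * (1 - k * md k s') - (1 - k * md k s) * sn k s') * md k t := by
    rw [e3]; ring
  linarith

/-- The comparison cosines are monotone in both legs and bounded below by `-1`, so they converge to
their infimum, which bounds each of them from below. -/
theorem StewartOn.exists_hasCosAngle {k ρ : ℝ} {x y p q : X} (hS : StewartOn k x ρ)
    (hρ : 0 < k → ρ ≤ Real.pi / √k) (hy : dist y x < ρ / 2) (hp : p ≠ y) (hq : q ≠ y)
    {γ σ : ℝ → X} (hγ : IsMinimalGeodesic γ y p) (hσ : IsMinimalGeodesic σ y q) :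
    ∃ A, HasCosAngle k γ σ A ∧ ∀ s t, 0 < s → s ≤ dist y p → s < ρ / 2 → 0 < t →
      t ≤ dist y q → t < ρ / 2 → A ≤ cosAngle k s t (dist (γ s) (σ t)) := by
  have hρ0 : 0 < ρ / 2 := lt_of_le_of_lt dist_nonneg hy
  have hp' : 0 < dist y p := dist_pos.2 hp.symm
  have hq' : 0 < dist y q := dist_pos.2 hq.symm
  let f : ℝ × ℝ → ℝ := fun x => cosAngle k x.1 x.2 (dist (γ x.1) (σ x.2))
  let S : Set (ℝ × ℝ) := {z | (0 < z.1 ∧ z.1 ≤ dist y p ∧ z.1 < ρ / 2) ∧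
    (0 < z.2 ∧ z.2 ≤ dist y q ∧ z.2 < ρ / 2)}
  have hmono : ∀ z ∈ S, ∀ w ∈ S, z.1 ≤ w.1 → z.2 ≤ w.2 → f z ≤ f w := by
    rintro ⟨s', t'⟩ ⟨⟨hs1, hs2, hs3⟩, ht1, ht2, ht3⟩ ⟨s, t⟩ ⟨⟨hs4, hs5, hs6⟩, ht4, ht5, ht6⟩ hs ht
    refine (hS.cosAngle_le hρ hy hγ hσ hs1 hs hs5 hs6 ht1 ht2 ht3).trans ?_
    have := hS.cosAngle_le hρ hy hσ hγ ht1 ht ht5 ht6 hs4 hs5 hs6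
    simp only [f]
    rwa [cosAngle_comm k s t', cosAngle_comm k s t, dist_comm, dist_comm (γ s)]
  have hbdd : BddBelow (f '' S) := by
    refine ⟨-1, ?_⟩
    rintro _ ⟨⟨s, t⟩, ⟨⟨hs1, hs2, hs3⟩, ht1, ht2, ht3⟩, rfl⟩
    refine neg_one_le_cosAngle hs1 ht1 dist_nonneg ?_ fun hk => by
      have := hρ hk
      simp only at hs3 ht3
      linarith
    have := dist_triangle_left (γ s) (σ t) y
    rwa [hγ.dist_left hs1.le hs2, hσ.dist_left ht1.le ht2] at this
  have hle : ∀ z ∈ S, sInf (f '' S) ≤ f z := fun z hz => csInf_le hbdd ⟨z, hz, rfl⟩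
  have hev : ∀ᶠ z : ℝ × ℝ in 𝓝[>] (0 : ℝ) ×ˢ 𝓝[>] (0 : ℝ), z ∈ S := by
    filter_upwards [eventually_prod_nhdsGT (lt_min hp' hρ0) (lt_min hq' hρ0)] with z hz
    exact ⟨⟨hz.1.1, hz.1.2.le.trans (min_le_left _ _), hz.1.2.trans_le (min_le_right _ _)⟩,
      hz.2.1, hz.2.2.le.trans (min_le_left _ _), hz.2.2.trans_le (min_le_right _ _)⟩
  refine ⟨sInf (f '' S), tendsto_order.2 ⟨fun a ha => ?_, fun a ha => ?_⟩,
    fun s t h1 h2 h3 h4 h5 h6 => hle (s, t) ⟨⟨h1, h2, h3⟩, h4, h5, h6⟩⟩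
  · filter_upwards [hev] with z hz
    exact ha.trans_le (hle z hz)
  · obtain ⟨_, ⟨w, hw, rfl⟩, hwa⟩ := exists_lt_of_csInf_lt
      ((show S.Nonempty from hev.exists).image f) ha
    filter_upwards [hev, eventually_prod_nhdsGT hw.1.1 hw.2.1] with z hz hz'
    exact (hmono z hz w hw hz'.1.2.le hz'.2.2.le).trans_lt hwa

theorem HasCurvatureGE.exists_hasCosAngle {k : ℝ} (hX : HasCurvatureGE X k) {y p q : X}
    (hp : p ≠ y) (hq : q ≠ y) {γ σ : ℝ → X} (hγ : IsMinimalGeodesic γ y p)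
    (hσ : IsMinimalGeodesic σ y q) : ∃ A, HasCosAngle k γ σ A := by
  obtain ⟨ρ, h0, hρ, hS⟩ := hX.exists_stewartOn y
  obtain ⟨A, hA, -⟩ := hS.exists_hasCosAngle hρ (by simpa using h0) hp hq hγ hσ
  exact ⟨A, hA⟩

/-- The hinge comparison holds for all hinges with vertex `x` and endpoints `p`, `q`. -/
def HingeComparison (k : ℝ) (x p q : X) : Prop :=
  ∀ (γ σ : ℝ → X) (A : ℝ), IsMinimalGeodesic γ x p → IsMinimalGeodesic σ x q →
    HasCosAngle k γ σ A → md k (dist p q) ≤ hingeMd k (dist x p) (dist x q) A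

/-- The vertex `y` may vary near the centre `x`: one radius serves all vertices close to a limit
point. -/
theorem StewartOn.hingeComparison {k ρ : ℝ} {x y p q : X} (hS : StewartOn k x ρ)
    (hρ : 0 < k → ρ ≤ Real.pi / √k) (hy : dist y x < ρ / 2) (hp : dist y p < ρ / 2)
    (hq : dist y q < ρ / 2) : HingeComparison k y p q := by
  intro γ σ A hγ hσ hA
  by_cases hp0 : p = y
  · simp [hp0, hingeMd]
  by_cases hq0 : q = y
  · simp [hq0, hingeMd, dist_comm]
  have hp' : 0 < dist y p := dist_pos.2 (Ne.symm hp0)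
  have hq' : 0 < dist y q := dist_pos.2 (Ne.symm hq0)
  obtain ⟨B, hB, h⟩ := hS.exists_hasCosAngle hρ hy hp0 hq0 hγ hσ
  have := h _ _ hp' le_rfl hp hq' le_rfl hq
  rwa [hB.unique hA, hγ.2.1, hσ.2.1, le_cosAngle_iff] at this
  · exact sn_pos hp' fun hk => by linarith [hρ hk]
  · exact sn_pos hq' fun hk => by linarith [hρ hk]

/-- Adjacent angles add up to at most `π`. -/
theorem HasCurvatureGE.add_nonneg_of_adjacent {k : ℝ} (hX : HasCurvatureGE X k) {x p q : X} {h : ℝ}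
    {γ σ : ℝ → X} (hγ : IsMinimalGeodesic γ x p) (h0 : 0 < h) (h1 : h < dist x p)
    (hσ : IsMinimalGeodesic σ (γ h) q) (hq : q ≠ γ h) {A B : ℝ}
    (hA : HasCosAngle k (fun t => γ (h + t)) σ A) (hB : HasCosAngle k (fun t => γ (h - t)) σ B) :
    0 ≤ A + B := by
  obtain ⟨ρ, hρ0, hρ, hS⟩ := hX.exists_stewartOn (γ h)
  have hq' : 0 < dist (γ h) q := dist_pos.2 hq.symm
  refine ge_of_tendsto (hA.add hB) ?_
  filter_upwards [eventually_prod_nhdsGT (lt_min (lt_min h0 (sub_pos.2 h1)) (half_pos hρ0))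
    (lt_min hq' hρ0)] with ⟨s, t⟩ ⟨⟨hs, hs'⟩, ht, ht'⟩
  simp only [lt_min_iff] at hs hs' ht ht'
  have i0 : h ∈ Set.Icc 0 (dist x p) := ⟨h0.le, h1.le⟩
  have i1 : h + s ∈ Set.Icc 0 (dist x p) := ⟨by linarith, by linarith⟩
  have i2 : h - s ∈ Set.Icc 0 (dist x p) := ⟨by linarith, by linarith⟩
  have d1 := hγ.2.2 _ i2 _ i1
  have d2 := hγ.2.2 _ i2 _ i0
  have d3 := hγ.2.2 _ i0 _ i1
  have d4 := hσ.dist_left ht.le ht'.1.le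
  rw [show h - s - (h + s) = -(s + s) by ring, abs_neg, abs_of_pos (by linarith)] at d1
  rw [show h - s - h = -s by ring, abs_neg, abs_of_pos hs] at d2
  rw [show h - (h + s) = -s by ring, abs_neg, abs_of_pos hs] at d3
  -- At the midpoint `γ h` of `γ (h - s)` and `γ (h + s)`, Stewart's inequality says that the two
  -- comparison cosines have nonnegative sum.
  have key := hS (σ t) (by rw [Metric.mem_ball, dist_comm, d4]; exact ht'.2)
    (γ (h - s)) (by rw [Metric.mem_ball, d2]; linarith)
    (γ (h + s)) (by rw [Metric.mem_ball, dist_comm, d3]; linarith) (γ h)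
    (Metric.mem_ball_self hρ0) (by rw [d1, d2, d3])
  rw [d1, d2, d3, dist_comm _ (γ h), d4, dist_comm _ (γ (h - s)), dist_comm _ (γ (h + s)),
    sn_add'] at key
  have ps : 0 < sn k s := sn_pos hs fun hk => by linarith [hρ hk]
  have pt : 0 < sn k t := sn_pos ht fun hk => by linarith [hρ hk]
  rw [cosAngle, cosAngle, ← add_div]
  refine div_nonneg ?_ (by positivity)
  refine le_of_mul_le_mul_left (a := sn k s) ?_ ps
  linarith

end Local

/-! ### From small hinges to large ones. -/

section Global

variable {X : Type*} [MetricSpace X] {k : ℝ}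

/-- Moving the vertex of a hinge along one of its sides does not increase the side opposite to the
vertex of the hinge in `S²_k`. -/
theorem HasCurvatureGE.exists_hinge_step (hX : HasCurvatureGE X k)
    (hgeod : ∀ x y : X, ∃ γ : ℝ → X, IsMinimalGeodesic γ x y) {x p q : X} {γ σ : ℝ → X} {A h : ℝ}
    (hγ : IsMinimalGeodesic γ x p) (hσ : IsMinimalGeodesic σ x q) (hA : HasCosAngle k γ σ A)
    (h0 : 0 < h) (h1 : h < dist x p) (hk : 0 < k → dist x p ≤ Real.pi / √k)
    (hk' : 0 < k → dist (γ h) q ≤ Real.pi / √k) (hc1 : HingeComparison k x (γ h) q)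
    (hc2 : HingeComparison k (γ h) x q) :
    md k (dist (γ h) q) ≤ hingeMd k h (dist x q) A ∧
      (md k (dist p q) ≤ hingeMd k (dist x p) (dist x q) A ∨
        ∃ (γ' σ' : ℝ → X) (A' : ℝ), IsMinimalGeodesic γ' (γ h) p ∧ IsMinimalGeodesic σ' (γ h) q ∧
          HasCosAngle k γ' σ' A' ∧
          hingeMd k (dist x p - h) (dist (γ h) q) A' ≤ hingeMd k (dist x p) (dist x q) A) := by
  have d1 := hγ.dist_left h0.le h1.le
  have d2 := hγ.dist_right h0.le h1.le
  have e1 := hc1 γ σ A (hγ.initial h0.le h1.le) hσ hA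
  rw [d1] at e1
  refine ⟨e1, ?_⟩
  set a := dist x p
  set b := dist x q
  set b' := dist (γ h) q with hb'
  have ph : 0 < sn k h := sn_pos h0 fun hk0 => h1.trans_le (hk hk0)
  have pa : 0 ≤ sn k a := sn_nonneg dist_nonneg hk
  have pw : 0 ≤ sn k (a - h) := sn_nonneg (by linarith) fun hk0 => by linarith [hk hk0]
  have t1 := sn_mul_md_add k h (a - h)
  have t2 := sn_add' k h (a - h)
  have t3 := sn_add' k a (-h)
  rw [sn_neg, md_neg, ← sub_eq_add_neg] at t3
  rw [add_sub_cancel] at t1 t2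
  unfold hingeMd at e1
  -- the model side of a hinge at `γ h` whose angle is at least that of the model triangle
  have main : ∀ S : ℝ, md k b ≤ md k h + md k b' - k * md k h * md k b' + S →
      md k (a - h) + md k b' - k * md k (a - h) * md k b' - sn k (a - h) * (S / sn k h)
        ≤ hingeMd k a b A := by
    intro S hS
    -- Alexandrov's lemma in algebraic form: `hS` times `sn k (a - h)` plus `e1` times `sn k a`,
    -- simplified by the addition formulas.
    refine le_of_mul_le_mul_left (a := sn k h) ?_ ph
    have m1 := mul_le_mul_of_nonneg_left hS pw
    have m2 := mul_le_mul_of_nonneg_left e1 pa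
    unfold hingeMd
    have m3 : sn k h * (sn k (a - h) * (S / sn k h)) = sn k (a - h) * S := by
      field_simp
    linear_combination m1 + m2 - m3 - md k b' * t2 - t1 - md k b * t3
  -- Here there is no new hinge, as the leg to `q` degenerates; `main` with `S = 0` gives the
  -- comparison directly.
  by_cases hq : q = γ h
  · left
    have b0 : b' = 0 := by rw [hb', hq, dist_self]
    have bh : b = h := by rw [← d1, ← hq]
    have := main 0 (by rw [b0, bh]; simp)
    rw [hq, dist_comm, d2]
    simpa [b0] using this
  · right
    obtain ⟨σ', hσ'⟩ := hgeod (γ h) q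
    have hp' : p ≠ γ h := by rw [ne_comm, ← dist_pos, d2]; linarith
    have hx' : x ≠ γ h := by rw [← dist_pos, d1]; exact h0
    have hγ' := hγ.shift h0.le h1.le
    have hγ'' := hγ.reverse h0.le h1.le
    obtain ⟨A', hA'⟩ := hX.exists_hasCosAngle hp' hq hγ' hσ'
    obtain ⟨B', hB'⟩ := hX.exists_hasCosAngle hx' hq hγ'' hσ'
    have hAB := hX.add_nonneg_of_adjacent hγ h0 h1 hσ' hq hA' hB'
    have e2 := hc2 _ _ _ hγ'' hσ' hB'
    rw [dist_comm _ x, d1] at e2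
    refine ⟨_, σ', A', hγ', hσ', hA', ?_⟩
    have pb' : 0 ≤ sn k b' := sn_nonneg dist_nonneg hk'
    -- The angle `A'` towards `p` may be replaced by the supplement of the angle towards `x`,
    -- because `-B' ≤ A'`.
    refine le_trans ?_ (main (-(sn k h * sn k b' * B')) e2)
    have m4 : -(sn k h * sn k b' * B') / sn k h = -(sn k b' * B') := by field_simp
    rw [m4, hingeMd]
    nlinarith [mul_nonneg (mul_nonneg pw pb') hAB]

/-- If the hinge comparison holds for all hinges of size at most `5 / 6 * L` near a point, then it
holds for the hinges of size at most `L` at this point. -/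
theorem HasCurvatureGE.hingeComparison_of_smaller (hX : HasCurvatureGE X k)
    (hgeod : ∀ x y : X, ∃ γ : ℝ → X, IsMinimalGeodesic γ x y) {x₀ : X} {L : ℝ} (hL : 0 < L)
    (hLk : 0 < k → L ≤ Real.pi / √k)
    (H : ∀ y u v : X, dist x₀ y ≤ 2 * L → dist y u + dist y v ≤ 5 / 6 * L →
      HingeComparison k y u v)
    {p q : X} (hpq : dist x₀ p + dist x₀ q ≤ L) : HingeComparison k x₀ p q := by
  obtain ⟨C, hC, hsn⟩ : ∃ C > 0, ∀ a ∈ Set.Icc 0 L, sn k a ≤ C := by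
    obtain ⟨C, hC⟩ := (isCompact_Icc.image (continuous_sn k)).bddAbove (s := sn k '' Set.Icc 0 L)
    exact ⟨max C 1, by positivity, fun a ha => (hC ⟨a, ha, rfl⟩).trans (le_max_left _ _)⟩
  have ph : 0 < sn k (L / 9) := sn_pos (by linarith) fun hk => by linarith [hLk hk]
  have claim : ∀ ε > 0, ∃ δ > 0, ∀ (N : ℕ) (p q y : X), dist x₀ p ≤ L → dist x₀ q ≤ L →
      dist y p + dist y q ≤ L → dist y p + dist y q ≤ 5 / 6 * L + N * δ →
      ∀ (γ σ : ℝ → X) (A : ℝ), IsMinimalGeodesic γ y p → IsMinimalGeodesic σ y q →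
        HasCosAngle k γ σ A → md k (dist p q) - ε ≤ hingeMd k (dist y p) (dist y q) A := by
    intro ε hε
    have hunif := isCompact_Icc (a := 0) (b := 2 * L) |>.uniformContinuousOn_of_continuous
      (continuous_md k).continuousOn
    obtain ⟨δ, hδ, hmd⟩ := Metric.uniformContinuousOn_iff.1 hunif (ε * sn k (L / 9) / C)
      (by positivity)
    refine ⟨δ, hδ, fun N => ?_⟩
    induction N with
    | zero =>
      intro p q y hp hq _ hψ γ σ A hγ hσ hA
      have := H y p q (by linarith [dist_triangle_right x₀ y p, dist_nonneg (x := y) (y := q)])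
        (by simpa using hψ) γ σ A hγ hσ hA
      linarith
    | succ N ih =>
      -- the longer of the two sides is cut
      have aux : ∀ (p q y : X), dist y q ≤ dist y p → dist x₀ p ≤ L → dist x₀ q ≤ L →
          dist y p + dist y q ≤ L → dist y p + dist y q ≤ 5 / 6 * L + (N + 1 : ℕ) * δ →
          ∀ (γ σ : ℝ → X) (A : ℝ), IsMinimalGeodesic γ y p → IsMinimalGeodesic σ y q →
          HasCosAngle k γ σ A → md k (dist p q) - ε ≤ hingeMd k (dist y p) (dist y q) A := by
        intro p q y hqp hp hq hψ hψN γ σ A hγ hσ hA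
        have n1 := dist_nonneg (x := y) (y := q)
        have hy : dist x₀ y ≤ 2 * L := by linarith [dist_triangle_right x₀ y p]
        by_cases hsmall : dist y p + dist y q ≤ 5 / 6 * L
        · linarith [H y p q hy hsmall γ σ A hγ hσ hA]
        push Not at hsmall
        -- The longer leg exceeds `5/12 * L`, so it can be cut at `L / 9`. The shorter leg is at
        -- most `L / 2`, so the two auxiliary hinges have sizes at most `L/9 + L/2` and `2 * L/9 +
        -- L/2`, both below `5/6 * L`.
        have h0 : (0 : ℝ) < L / 9 := by linarith
        have h1 : L / 9 < dist y p := by linarith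
        have d1 := hγ.dist_left h0.le h1.le
        have d2 := hγ.dist_right h0.le h1.le
        have d3 := dist_triangle_left (γ (L / 9)) q y
        rw [d1] at d3
        have d4 : dist x₀ (γ (L / 9)) ≤ 2 * L := by
          linarith [dist_triangle_right x₀ (γ (L / 9)) p]
        obtain ⟨s1, s2⟩ := hX.exists_hinge_step hgeod hγ hσ hA h0 h1
          (fun hk => by linarith [hLk hk]) (fun hk => by linarith [hLk hk])
          (H _ _ _ hy (by linarith)) (H _ _ _ d4 (by rw [dist_comm _ y, d1]; linarith))
        rcases s2 with s2 | ⟨γ', σ', A', hγ', hσ', hA', s2⟩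
        · linarith
        -- Either the size drops by `δ` and the induction applies, or the triangle inequality at `y`
        -- is almost sharp. Then uniform continuity of `md` bounds `sn k (dist y q) * (1 + A)` by `ε
        -- / C`, and `|pq| ≤ |yp| + |yq|` suffices.
        by_cases hdec : dist (γ (L / 9)) q ≤ L / 9 + dist y q - δ
        · have := ih p q (γ (L / 9)) hp hq (by rw [d2]; linarith) (by
            rw [d2]; push_cast at hψN; linarith) γ' σ' A' hγ' hσ' hA'
          rw [d2] at this
          linarith
        · push Not at hdec
          have hm := hmd (L / 9 + dist y q) ⟨by linarith, by linarith⟩ (dist (γ (L / 9)) q)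
            ⟨dist_nonneg, by linarith⟩ (by
              rw [Real.dist_eq, abs_of_nonneg] <;> linarith)
          have hm' := (le_abs_self _).trans_lt hm
          rw [hingeMd_eq_md_add_sub] at s1 ⊢
          have hu : sn k (dist y q) * (1 + A) ≤ ε / C := by
            rw [le_div_iff₀ hC]
            refine le_of_mul_le_mul_left (a := sn k (L / 9)) ?_ ph
            rw [lt_div_iff₀ hC] at hm'
            nlinarith
          have hle : md k (dist p q) ≤ md k (dist y p + dist y q) :=
            md_le_md dist_nonneg (dist_triangle_left p q y) fun hk => by linarith [hLk hk]
          have pa : 0 ≤ sn k (dist y p) := sn_nonneg dist_nonneg fun hk => by linarith [hLk hk]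
          have hfin : sn k (dist y p) * (sn k (dist y q) * (1 + A)) ≤ ε :=
            calc _ ≤ sn k (dist y p) * (ε / C) := mul_le_mul_of_nonneg_left hu pa
              _ ≤ C * (ε / C) := mul_le_mul_of_nonneg_right
                  (hsn _ ⟨dist_nonneg, by linarith⟩) (by positivity)
              _ = ε := mul_div_cancel₀ _ hC.ne'
          linarith
      intro p q y hp hq hψ hψN γ σ A hγ hσ hA
      rcases le_total (dist y q) (dist y p) with h | h
      · exact aux p q y h hp hq hψ hψN γ σ A hγ hσ hA
      · rw [dist_comm, hingeMd_comm]
        exact aux q p y h hq hp (by linarith) (by linarith) σ γ A hσ hγ hA.symm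
  intro γ σ A hγ hσ hA
  have n1 := dist_nonneg (x := x₀) (y := p)
  have n2 := dist_nonneg (x := x₀) (y := q)
  refine le_of_forall_pos_sub_le fun ε hε => ?_
  obtain ⟨δ, hδ, h⟩ := claim ε hε
  obtain ⟨N, hN⟩ := exists_nat_gt (L / δ)
  rw [div_lt_iff₀ hδ] at hN
  exact h N p q x₀ (by linarith) (by linarith) hpq (by linarith) γ σ A hγ hσ hA

/-- The hinge comparison holds for all hinges of size at most `π/√k`. -/
theorem HasCurvatureGE.hingeComparison_of_size_le [CompleteSpace X] (hX : HasCurvatureGE X k)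
    (hgeod : ∀ x y : X, ∃ γ : ℝ → X, IsMinimalGeodesic γ x y) {x p q : X}
    (hk : 0 < k → dist x p + dist x q ≤ Real.pi / √k) : HingeComparison k x p q := by
  by_contra hbad
  let size : X × X × X → ℝ := fun z => dist z.1 z.2.1 + dist z.1 z.2.2
  let Bad : Type _ := {z : X × X × X //
    (0 < k → size z ≤ Real.pi / √k) ∧ ¬ HingeComparison k z.1 z.2.1 z.2.2}
  -- Contrapositive of the size reduction: every bad hinge has a smaller bad hinge nearby.
  have hnext : ∀ z : Bad, ∃ w : Bad, dist z.1.1 w.1.1 ≤ 2 * size z.1 ∧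
      size w.1 ≤ 5 / 6 * size z.1 := by
    rintro ⟨⟨y, u, v⟩, hyk, hy⟩
    have n1 := dist_nonneg (x := y) (y := u)
    have n2 := dist_nonneg (x := y) (y := v)
    simp only [size] at hyk hy ⊢
    have hL : 0 < dist y u + dist y v := by
      by_contra! h
      have e1 : y = u := dist_eq_zero.1 (by linarith)
      have e2 : y = v := dist_eq_zero.1 (by linarith)
      subst e1
      subst e2
      exact hy fun γ σ A _ _ _ => by simp [hingeMd]
    by_contra! hno
    refine hy (hX.hingeComparison_of_smaller hgeod hL hyk (fun y' u' v' h1 h2 => ?_) le_rfl)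
    by_contra hy'
    have := hno ⟨(y', u', v'), fun h => by simp only [size]; linarith [hyk h], hy'⟩ h1
    simp only at this
    linarith
  choose next hnext1 hnext2 using hnext
  let z : ℕ → Bad := fun n => next^[n] ⟨(x, p, q), hk, hbad⟩
  have hz : ∀ n, z (n + 1) = next (z n) := fun n => Function.iterate_succ_apply' _ _ _
  set L := size (x, p, q)
  have hsize : ∀ n, size (z n).1 ≤ L * (5 / 6) ^ n := by
    intro n
    induction n with
    | zero => simp [z, L]
    | succ n ih =>
      rw [hz, pow_succ]
      linarith [hnext2 (z n)]
  have hcauchy : CauchySeq fun n => (z n).1.1 := by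
    refine cauchySeq_of_le_geometric (5 / 6) (2 * L) (by norm_num) fun n => ?_
    rw [hz]
    linarith [hnext1 (z n), hsize n]
  obtain ⟨o, ho⟩ := cauchySeq_tendsto_of_complete hcauchy
  obtain ⟨ρ, hρ0, hρ, hS⟩ := hX.exists_stewartOn o
  have hsz : Tendsto (fun n => L * (5 / 6 : ℝ) ^ n) atTop (𝓝 0) := by
    simpa using (tendsto_pow_atTop_nhds_zero_of_lt_one (by norm_num) (by norm_num)).const_mul L
  obtain ⟨n, h1, h2⟩ := ((ho.eventually (Metric.ball_mem_nhds o (half_pos hρ0))).and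
    (hsz.eventually (gt_mem_nhds (half_pos hρ0)))).exists
  have h3 := hsize n
  simp only [size] at h3
  exact (z n).2.2 (hS.hingeComparison hρ h1
    (by linarith [dist_nonneg (x := (z n).1.1) (y := (z n).1.2.2)])
    (by linarith [dist_nonneg (x := (z n).1.1) (y := (z n).1.2.1)]))

/-- The vertex slides towards `p` in steps of fixed length until it is within one step of `p`; by
the triangle inequality the perimeter does not grow meanwhile. -/
theorem HasCurvatureGE.hingeComparison_of_perimeter_lt [CompleteSpace X] (hX : HasCurvatureGE X k)
    (hgeod : ∀ x y : X, ∃ γ : ℝ → X, IsMinimalGeodesic γ x y) (hk : 0 < k) {x p q : X}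
    (hper : dist x p + dist x q + dist p q < 2 * Real.pi / √k) : HingeComparison k x p q := by
  set M := (dist x p + dist x q + dist p q) / 2 with hM
  -- Every leg is at most the half-perimeter `M`, so the auxiliary hinges have size at most `M + 2 *
  -- h = π/√k`.
  set h := (Real.pi / √k - M) / 2 with hh
  have hMk : M < Real.pi / √k := by rw [mul_div_assoc] at hper; linarith
  have h0 : 0 < h := by linarith
  have claim : ∀ (n : ℕ) (y : X) (γ σ : ℝ → X) (A : ℝ), dist y p ≤ n * h →
      dist y p + dist y q + dist p q ≤ 2 * M → IsMinimalGeodesic γ y p → IsMinimalGeodesic σ y q →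
      HasCosAngle k γ σ A → md k (dist p q) ≤ hingeMd k (dist y p) (dist y q) A := by
    intro n
    induction n with
    | zero =>
      intro y γ σ A hn _ _ _ _
      have : y = p := dist_le_zero.1 (by simpa using hn)
      simp [this, hingeMd]
    | succ n ih =>
      intro y γ σ A hn hy hγ hσ hA
      have hqM : dist y q ≤ M := by linarith [dist_triangle y p q]
      have hpM : dist y p ≤ M := by linarith [dist_triangle_right y p q]
      by_cases h1 : dist y p ≤ h
      · exact hX.hingeComparison_of_size_le hgeod (fun _ => by linarith) γ σ A hγ hσ hA
      push Not at h1
      have d1 := hγ.dist_left h0.le h1.le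
      have d2 := hγ.dist_right h0.le h1.le
      have d3 := dist_triangle_left (γ h) q y
      have d4 := dist_triangle (γ h) p q
      rw [d1] at d3
      obtain ⟨-, s | ⟨γ', σ', A', hγ', hσ', hA', s⟩⟩ := hX.exists_hinge_step hgeod hγ hσ hA h0 h1
        (fun _ => by linarith) (fun _ => by linarith)
        (hX.hingeComparison_of_size_le hgeod fun _ => by linarith)
        (hX.hingeComparison_of_size_le hgeod fun _ => by rw [dist_comm _ y]; linarith)
      · exact s
      · have := ih (γ h) γ' σ' A' (by rw [d2]; push_cast at hn; linarith) (by linarith)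
          hγ' hσ' hA'
        rw [d2] at this
        linarith
  intro γ σ A hγ hσ hA
  obtain ⟨n, hn⟩ := exists_nat_gt (dist x p / h)
  rw [div_lt_iff₀ h0] at hn
  exact claim n x γ σ A hn.le (by linarith) hγ hσ hA

/-- Comparison just before the first `γ t` at which the triangle on `x`, `γ t`, `q` has full
perimeter passes to the limit. There it forces `A ≤ -1`, which settles the whole hinge. -/
theorem HasCurvatureGE.hingeComparison_of_perimeter_eq [CompleteSpace X] (hX : HasCurvatureGE X k)
    (hgeod : ∀ x y : X, ∃ γ : ℝ → X, IsMinimalGeodesic γ x y) (hk : 0 < k) {x p q : X}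
    (hp : dist x p < Real.pi / √k) (hq : dist x q < Real.pi / √k)
    (hper : dist x p + dist x q + dist p q = 2 * Real.pi / √k) : HingeComparison k x p q := by
  intro γ σ A hγ hσ hA
  have hqx : q ≠ x := by
    rintro rfl
    rw [dist_self, dist_comm p, mul_div_assoc] at hper
    linarith
  have hq0 : 0 < dist x q := dist_pos.2 hqx.symm
  have hcont : ContinuousOn (fun t => dist (γ t) q) (Set.Icc 0 (dist x p)) := by
    have h1 : ContinuousOn γ (Set.Icc 0 (dist x p)) :=
      (LipschitzOnWith.of_dist_le_mul (K := 1) fun s hs t ht => by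
        rw [hγ.2.2 s hs t ht, Real.dist_eq, NNReal.coe_one, one_mul]).continuousOn
    fun_prop
  let S : Set ℝ := Set.Icc 0 (dist x p) ∩
    (fun t => t + dist (γ t) q) ⁻¹' {2 * Real.pi / √k - dist x q}
  have hS : IsCompact S := isCompact_Icc.of_isClosed_subset
    ((continuousOn_id.add hcont).preimage_isClosed_of_isClosed isClosed_Icc isClosed_singleton)
    Set.inter_subset_left
  have hne : S.Nonempty := ⟨dist x p, ⟨dist_nonneg, le_rfl⟩, by
    simp only [Set.mem_preimage, Set.mem_singleton_iff, hγ.2.1]; linarith⟩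
  obtain ⟨t, ⟨ht, htS⟩, hleast⟩ := hS.exists_isLeast hne
  simp only [Set.mem_preimage, Set.mem_singleton_iff] at htS
  have ht0 : 0 < t := by
    rcases ht.1.eq_or_lt with h | h
    · rw [← h, hγ.1, mul_div_assoc] at htS
      linarith
    · exact h
  have hbefore : ∀ s ∈ Set.Ico 0 t, md k (dist (γ s) q) ≤ hingeMd k s (dist x q) A := by
    intro s hs
    have hs' : s ∈ Set.Icc 0 (dist x p) := ⟨hs.1, hs.2.le.trans ht.2⟩
    have d1 := hγ.dist_left hs'.1 hs'.2
    have d2 := hγ.dist_right hs'.1 hs'.2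
    have d3 := dist_triangle (γ s) p q
    have hlt : s + dist (γ s) q < 2 * Real.pi / √k - dist x q := by
      refine lt_of_le_of_ne (by linarith) fun h => ?_
      exact absurd (hleast ⟨hs', h⟩) hs.2.not_ge
    have := hX.hingeComparison_of_perimeter_lt hgeod hk (x := x) (p := γ s) (q := q)
      (by rw [d1]; linarith) γ σ A (hγ.initial hs'.1 hs'.2) hσ hA
    rwa [d1] at this
  have hlim : md k (dist (γ t) q) ≤ hingeMd k t (dist x q) A := by
    have hsub : Set.Ico 0 t ⊆ Set.Icc 0 (dist x p) := fun s hs => ⟨hs.1, hs.2.le.trans ht.2⟩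
    refine ContinuousWithinAt.closure_le (s := Set.Ico 0 t)
      (f := fun s => md k (dist (γ s) q)) (g := fun s => hingeMd k s (dist x q) A) ?_ ?_ ?_ hbefore
    · rw [closure_Ico ht0.ne]; exact ⟨ht0.le, le_rfl⟩
    · exact (continuous_md k).continuousAt.comp_continuousWithinAt ((hcont t ht).mono hsub)
    · have := continuous_md k
      have := continuous_sn k
      unfold hingeMd
      fun_prop
  have e : dist (γ t) q = 2 * Real.pi / √k - (t + dist x q) := by linarith
  -- Full perimeter means that the opposite side has the same `md` as the sum of the legs.
  rw [e, md_two_pi_div_sub hk, hingeMd_eq_md_add_sub] at hlim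
  have pt : 0 < sn k t := sn_pos ht0 fun _ => ht.2.trans_lt hp
  have pq : 0 < sn k (dist x q) := sn_pos hq0 fun _ => hq
  have pp : 0 ≤ sn k (dist x p) := sn_nonneg dist_nonneg fun _ => hp.le
  have hA1 : 1 + A ≤ 0 := by
    by_contra! h
    have := mul_pos (mul_pos pt pq) h
    linarith
  have e' : dist p q = 2 * Real.pi / √k - (dist x p + dist x q) := by linarith
  rw [e', md_two_pi_div_sub hk, hingeMd_eq_md_add_sub]
  nlinarith [mul_nonneg (mul_nonneg pp pq.le) (neg_nonneg.2 hA1)]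

/-! ### Independence of the angle from the model curvature. -/

/-- The cosine of the angle measured by comparison with `S²_k` is the cosine of the angle. -/
theorem HasCosAngle.hasAngle {q p r : X} {γ σ : ℝ → X} {A : ℝ} (hA : HasCosAngle k γ σ A)
    (hγ : IsMinimalGeodesic γ q p) (hσ : IsMinimalGeodesic σ q r) (hp : p ≠ q) (hr : r ≠ q) :
    HasAngle q γ σ (Real.arccos A) := by
  have hp' : 0 < dist q p := dist_pos.2 hp.symm
  have hr' : 0 < dist q r := dist_pos.2 hr.symm
  set l : Filter (ℝ × ℝ) := 𝓝[>] (0 : ℝ) ×ˢ 𝓝[>] (0 : ℝ) with hl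
  -- The quotient `sn k x / x`, extended by `1` at `0`: the arguments `(c ± (a - b)) / 2` vanish for
  -- degenerate triangles.
  let ρ : ℝ → ℝ := dslope (sn k) 0
  have hρ : Tendsto ρ (𝓝 0) (𝓝 1) := by
    have h1 : ContinuousAt ρ 0 :=
      continuousAt_dslope_same.2 (hasDerivAt_sn_zero k).differentiableAt
    have h2 : ρ 0 = 1 := by simp [ρ, dslope_same, (hasDerivAt_sn_zero k).deriv]
    simpa [h2] using h1.tendsto
  have hsn : ∀ x, sn k x = x * ρ x := fun x => by
    have := sub_smul_dslope (sn k) 0 x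
    simpa using this.symm
  have hs : Tendsto (fun z : ℝ × ℝ => z.1) l (𝓝 0) :=
    (tendsto_nhds_of_tendsto_nhdsWithin tendsto_id).comp tendsto_fst
  have ht : Tendsto (fun z : ℝ × ℝ => z.2) l (𝓝 0) :=
    (tendsto_nhds_of_tendsto_nhdsWithin tendsto_id).comp tendsto_snd
  have hev := eventually_prod_nhdsGT hp' hr'
  have hd : Tendsto (fun z : ℝ × ℝ => dist (γ z.1) (σ z.2)) l (𝓝 0) := by
    refine squeeze_zero' (Eventually.of_forall fun _ => dist_nonneg) ?_
      (by simpa using hs.add ht)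
    filter_upwards [hev] with z hz
    have := dist_triangle_left (γ z.1) (σ z.2) q
    rwa [hγ.dist_left hz.1.1.le hz.1.2.le, hσ.dist_left hz.2.1.le hz.2.2.le] at this
  have hu : Tendsto (fun z : ℝ × ℝ => (dist (γ z.1) (σ z.2) + (z.1 - z.2)) / 2) l (𝓝 0) := by
    simpa using (hd.add (hs.sub ht)).div_const 2
  have hv : Tendsto (fun z : ℝ × ℝ => (dist (γ z.1) (σ z.2) - (z.1 - z.2)) / 2) l (𝓝 0) := by
    simpa using (hd.sub (hs.sub ht)).div_const 2
  have hlim : Tendsto (fun z : ℝ × ℝ => 1 - (1 - cosAngle k z.1 z.2 (dist (γ z.1) (σ z.2))) *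
      ((ρ z.1 * ρ z.2) / (ρ ((dist (γ z.1) (σ z.2) + (z.1 - z.2)) / 2) *
        ρ ((dist (γ z.1) (σ z.2) - (z.1 - z.2)) / 2)))) l (𝓝 A) := by
    have h1 := ((hρ.comp hs).mul (hρ.comp ht)).div ((hρ.comp hu).mul (hρ.comp hv)) (by simp)
    have h2 := ((hA.const_sub 1).mul h1).const_sub 1
    simpa using h2
  refine ((Real.continuous_arccos.tendsto A).comp hlim).congr' ?_
  have hne : ∀ᶠ x in 𝓝 (0 : ℝ), ρ x ≠ 0 := hρ.eventually_ne one_ne_zero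
  filter_upwards [hev, hs.eventually hne, ht.eventually hne, hu.eventually hne,
    hv.eventually hne] with z hz n1 n2 n3 n4
  have z1 : z.1 ≠ 0 := hz.1.1.ne'
  have z2 : z.2 ≠ 0 := hz.2.1.ne'
  rw [Function.comp_apply, euclideanComparisonAngle, hγ.dist_left hz.1.1.le hz.1.2.le,
    hσ.dist_left hz.2.1.le hz.2.2.le, one_sub_cosAngle (by rw [hsn]; positivity)
    (by rw [hsn]; positivity), hsn z.1, hsn z.2, hsn ((_ + _) / 2), hsn ((_ - _) / 2)]
  congr 1
  field_simp
  ring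

end Global

/-! ### Toponogov's theorem. -/

theorem theoremA {X : Type*} [MetricSpace X] [CompleteSpace X] (k : ℝ)
    (hgeod : ∀ x y : X, ∃ γ : ℝ → X, IsMinimalGeodesic γ x y)
    (hcurv : HasCurvatureGE X k)
    (p q r : X) (hpq : p ≠ q) (hrq : r ≠ q)
    (γ σ τ : ℝ → X) (hγ : IsMinimalGeodesic γ q p) (hσ : IsMinimalGeodesic σ q r)
    (hτ : IsMinimalGeodesic τ p r) :
    ∃ α : ℝ, HasAngle q γ σ α ∧
      ∀ p' q' r' : ModelPlane k, IsComparisonTriangle p q r p' q' r' →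
        ModelPlane.mangle p' q' r' ≤ α := by
  obtain ⟨A, hA⟩ := hcurv.exists_hasCosAngle hpq hrq hγ hσ
  refine ⟨Real.arccos A, hA.hasAngle hγ hσ hpq hrq, fun p' q' r' ⟨e1, e2, e3⟩ => ?_⟩
  rw [ModelPlane.mdist_comm, dist_comm] at e1
  have hp := sn_nonneg (ModelPlane.mdist_nonneg q' p') fun hk => ModelPlane.mdist_le hk q' p'
  have hr := sn_nonneg (ModelPlane.mdist_nonneg q' r') fun hk => ModelPlane.mdist_le hk q' r'
  -- A leg of length `π/√k`, where the comparison angle is `0` by convention.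
  by_cases h0 : sn k (q'.mdist p') = 0 ∨ sn k (q'.mdist r') = 0
  · rw [ModelPlane.mangle_eq_zero _ _ _ h0]
    exact Real.arccos_nonneg A
  push Not at h0
  replace hp := lt_of_le_of_ne hp h0.1.symm
  replace hr := lt_of_le_of_ne hr h0.2.symm
  rw [ModelPlane.mangle_eq_arccos _ _ _ hp hr]
  refine Real.antitone_arccos ?_
  rw [le_cosAngle_iff hp hr, e1, e2, e3]
  refine (?_ : HingeComparison k q p r) γ σ A hγ hσ hA
  by_cases hk : 0 < k
  -- The perimeter bound comes from the mere existence of the comparison triangle.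
  · have hper := ModelPlane.perimeter_le hk q' p' r'
    rw [e1, e2, e3] at hper
    rcases hper.lt_or_eq with h | h
    · exact hcurv.hingeComparison_of_perimeter_lt hgeod hk h
    · refine hcurv.hingeComparison_of_perimeter_eq hgeod hk ?_ ?_ h
      · rw [← e1]
        exact lt_of_le_of_ne (ModelPlane.mdist_le hk q' p') fun h => h0.1 (h ▸ sn_pi_div hk)
      · rw [← e3]
        exact lt_of_le_of_ne (ModelPlane.mdist_le hk q' r') fun h => h0.2 (h ▸ sn_pi_div hk)
  · exact hcurv.hingeComparison_of_size_le hgeod fun h => absurd h hk
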